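/- All graphs are finite and simple. A graph is \((3,\ell)\)-regular if every vertex has degree \(3\) or \(\ell\), with at least one vertex of degree \(3\) and at least one vertex of degree \(\ell\). A graph is hamiltonian if it has a hamiltonian cycle; hamiltonian cycles are counted as subgraphs (i.e. by their edge sets). The connectivity of a graph is the least number of vertices whose deletion leaves a disconnected graph or a graph with at most one vertex. For every \(\kappa\in\{2,3\}\) and every integer \(k\ge 2\) there exists a hamiltonian \((3,2k+1)\)-regular graph of connectivity \(\kappa\) containing at most four hamiltonian cycles. The smallest order of a \((3,5)\)-regular graph with exactly four hamiltonian cycles is \(6\), and for every integer \(k\ge 3\) the smallest order of a \((3,2k+1)\)-regular graph with exactly four hamiltonian cycles is \(2k+4\). Moreover, for every integer \(k\ge 2\), among the \((3,2k+1)\)-regular graphs with exactly four hamiltonian cycles, there is one of minimum order that has connectivity \(2\). -/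

import Mathlib

namespace HamCount

open Classical in
/-- `G` is `(k, l)`-regular: every vertex has degree `k` or `l`, and both degrees occur. -/
def IsBiregular {V : Type*} [Fintype V] (G : SimpleGraph V) (k l : ℕ) : Prop :=
  (∀ v, G.degree v = k ∨ G.degree v = l) ∧ (∃ v, G.degree v = k) ∧ (∃ v, G.degree v = l)

/-- The Hamiltonian cycles of `G`, each given by its edge set, so that neither the starting
vertex nor the direction of traversal matters. -/
def hamiltonianCycles {V : Type*} [DecidableEq V] (G : SimpleGraph V) : Set (Set (Sym2 V)) :=
  {E | ∃ (a : V) (p : G.Walk a a), p.IsHamiltonianCycle ∧ E = p.edgeSet}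

/-- The number of Hamiltonian cycles of a finite graph. -/
noncomputable def numHamiltonianCycles {V : Type*} [Fintype V] [DecidableEq V]
    (G : SimpleGraph V) : ℕ :=
  (hamiltonianCycles G).ncard

/-- The (vertex) connectivity of a finite graph: the least number of vertices whose deletion
leaves a disconnected graph or at most one vertex. -/
noncomputable def vertexConnectivity {V : Type*} [Fintype V] (G : SimpleGraph V) : ℕ :=
  sInf {m | ∃ S : Finset V, S.card = m ∧
    (¬ (G.induce {v | v ∉ S}).Preconnected ∨ Fintype.card V ≤ S.card + 1)}

/-- `G` is a `(3, 2k+1)`-regular graph with exactly four Hamiltonian cycles. -/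
def IsFourCycleGraph (k : ℕ) {n : ℕ} (G : SimpleGraph (Fin n)) : Prop :=
  IsBiregular G 3 (2 * k + 1) ∧ numHamiltonianCycles G = 4

/-- The orders of the finite `(3, 2k+1)`-regular graphs with exactly four Hamiltonian cycles. -/
def fourCycleOrders (k : ℕ) : Set ℕ :=
  {n | ∃ G : SimpleGraph (Fin n), IsFourCycleGraph k G}

end HamCount

namespace HamCount

/-! Each of the three constructions contains two independent gadgets in which a Hamiltonian cycle
has exactly two options, while degree-three vertices force all its other edges. So a Hamiltonian
cycle is determined by two propositions (`injOn_edgeRel`), and there are at most four of them. For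
`dumbbellRel` and `joinRel` all four combinations are realised.

In the dumbbell the gadgets are the end triangles. Each sends exactly one edge to the hub, which is
then saturated, so the path between them is forced. In the join the gadgets are the two edges `0 1`
and `2 3`. In the three-hub graph they are the two ends of the path and the pair of vertices outside
it; together these saturate both large hubs. The dumbbell and the join have connectivity 2, the
three-hub graph 3.

For the lower bound, a vertex of degree `2 * k + 1` gives `n ≥ 2 * k + 2`, and `n` is even since all
degrees are odd. If `k ≥ 3` and `n = 2 * k + 2`, then `n ≥ 8` and high-degree vertices dominate. Two
of them are impossible in a hamiltonian graph that has a vertex of degree three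
(`not_two_dominating`). With only one, the graph is a wheel, which has too many Hamiltonian cycles
(`five_le_of_wheel`). -/

/-! ### Hamiltonian cycles as edge sets -/

/-- The properties of the edge set of a Hamiltonian cycle used below: it consists of edges of `G`,
every vertex is on exactly two of them, and they connect all vertices. -/
structure IsSpanningCycle {V : Type*} (G : SimpleGraph V) (E : Set (Sym2 V)) : Prop where
  adj : ∀ a b, s(a, b) ∈ E → G.Adj a b
  two : ∀ x, ∃ y z, y ≠ z ∧ ∀ a, s(x, a) ∈ E ↔ a = y ∨ a = z
  cut : ∀ X : V → Prop, (∀ a b, s(a, b) ∈ E → X a → X b) → ∀ a b, X a → X b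

theorem isSpanningCycle_of_mem {V : Type*} [DecidableEq V] {G : SimpleGraph V}
    {E : Set (Sym2 V)} (h : E ∈ hamiltonianCycles G) : IsSpanningCycle G E := by
  obtain ⟨a, p, hp, rfl⟩ := h
  refine ⟨fun a b hab => p.edges_subset_edgeSet hab, fun x => ?_, fun X hX b c hb => ?_⟩
  · have h2 := hp.isCycle.ncard_neighborSet_toSubgraph_eq_two (hp.mem_support x)
    obtain ⟨y, z, hyz, hs⟩ := Set.ncard_eq_two.1 h2
    refine ⟨y, z, hyz, fun b => ?_⟩
    rw [SimpleGraph.Walk.mem_edgeSet, ← SimpleGraph.Walk.adj_toSubgraph_iff_mem_edges]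
    have := Set.ext_iff.1 hs b
    simpa using this
  · by_contra hc
    have hstep : ∀ d e (_ : X d) (_ : ¬ X e) (q : G.Walk d e), q.edges ⊆ p.edges → False := by
      intro d e hd he q hq
      obtain ⟨w, hw, h1, h2⟩ := q.exists_boundary_dart {v | X v} hd he
      exact h2 (hX w.fst w.snd (hq (by
        rw [SimpleGraph.Walk.edges]; exact List.mem_map.2 ⟨w, hw, rfl⟩)) h1)
    -- The base point `a` lies inside or outside `X`; in either case a piece of the cycle runs from
    -- inside to outside, so some cycle edge leaves `X`.
    by_cases ha : X a
    · exact hstep a c ha hc (p.takeUntil c (hp.mem_support c)) (p.edges_takeUntil_subset_edges _)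
    · exact hstep b a hb ha (p.dropUntil b (hp.mem_support b)) (p.edges_dropUntil_subset_edges _)

theorem exists_walk_getVert {V : Type*} {G : SimpleGraph V} (m : ℕ) :
    ∀ f : ℕ → V, (∀ i < m, G.Adj (f i) (f (i + 1))) →
      ∃ p : G.Walk (f 0) (f m), p.length = m ∧ ∀ i ≤ m, p.getVert i = f i := by
  induction m with
  | zero => exact fun f _ => ⟨.nil, rfl, fun i hi => by simp [Nat.le_zero.1 hi]⟩
  | succ m ih =>
    intro f hf
    obtain ⟨p, hp, hg⟩ := ih (fun i => f (i + 1)) (fun i hi => hf (i + 1) (by omega))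
    refine ⟨.cons (hf 0 (by omega)) p, by simp [hp], fun i hi => ?_⟩
    cases i with
    | zero => simp
    | succ i => simpa using hg i (by omega)

/-- A cyclic enumeration of the vertices along edges gives a Hamiltonian cycle. -/
theorem exists_mem_hamiltonianCycles {V : Type*} [Fintype V] [DecidableEq V] {G : SimpleGraph V}
    {m : ℕ} (hm : 2 ≤ m) (hV : Fintype.card V = m + 1) (f : ℕ → V)
    (hinj : ∀ i j, i ≤ m → j ≤ m → f i = f j → i = j)
    (hadj : ∀ i < m, G.Adj (f i) (f (i + 1))) (hlast : G.Adj (f m) (f 0)) :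
    ∃ E ∈ hamiltonianCycles G, ∀ a b, s(a, b) ∈ E ↔
      (∃ i < m, a = f i ∧ b = f (i + 1) ∨ a = f (i + 1) ∧ b = f i) ∨
      (a = f m ∧ b = f 0 ∨ a = f 0 ∧ b = f m) := by
  obtain ⟨p, hp, hg⟩ := exists_walk_getVert m f hadj
  have hpath : p.IsPath := by
    rw [← SimpleGraph.Walk.IsPath.getVert_injOn_iff]
    intro i hi j hj hij
    simp only [Set.mem_ofPred_eq, hp] at hi hj
    rw [hg i hi, hg j hj] at hij
    exact hinj i j hi hj hij
  have hedge : ∀ a b, s(a, b) ∈ p.edges ↔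
      ∃ i < m, a = f i ∧ b = f (i + 1) ∨ a = f (i + 1) ∧ b = f i := by
    intro a b
    rw [SimpleGraph.Walk.mk_mem_edges_iff_exists]
    constructor
    · rintro ⟨i, hi, h⟩
      rw [hp] at hi
      rw [hg i (by omega), hg (i + 1) (by omega)] at h
      refine ⟨i, hi, ?_⟩
      aesop
    · rintro ⟨i, hi, h⟩
      refine ⟨i, by omega, ?_⟩
      rw [hg i (by omega), hg (i + 1) (by omega)]
      aesop
  refine ⟨_, ⟨f m, .cons hlast p, ?_, rfl⟩, fun a b => ?_⟩
  · rw [SimpleGraph.Walk.isHamiltonianCycle_iff_isCycle_and_length_eq]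
    refine ⟨(SimpleGraph.Walk.cons_isCycle_iff p hlast).2 ⟨hpath, fun h => ?_⟩, by simp [hp, hV]⟩
    obtain ⟨i, hi, ⟨h1, h2⟩ | ⟨h1, h2⟩⟩ := (hedge _ _).1 h
    · have := hinj _ _ le_rfl hi.le h1; omega
    · have := hinj _ _ le_rfl hi h1
      have := hinj _ _ (by omega) hi.le h2; omega
  · rw [SimpleGraph.Walk.mem_edgeSet, SimpleGraph.Walk.edges_cons, List.mem_cons, hedge, or_comm]
    simp

theorem isHamiltonian_of_mem {V : Type*} [Fintype V] [DecidableEq V] {G : SimpleGraph V}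
    {E : Set (Sym2 V)} (h : E ∈ hamiltonianCycles G) : G.IsHamiltonian := by
  obtain ⟨a, p, hp, -⟩ := h
  exact fun _ => ⟨a, p, hp⟩

/-! ### Connectivity via predicates constant along edges -/

theorem preconnected_induce_iff {V : Type*} {G : SimpleGraph V} {S : Finset V} :
    (G.induce {v | v ∉ S}).Preconnected ↔
      ∀ X : V → Prop, (∀ x y, x ∉ S → y ∉ S → G.Adj x y → (X x ↔ X y)) →
        ∀ x y, x ∉ S → y ∉ S → (X x ↔ X y) := by
  constructor
  · intro h X hX x y hx hy
    obtain ⟨p⟩ := h ⟨x, hx⟩ ⟨y, hy⟩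
    have : ∀ (a b : {v | v ∉ S}) (q : (G.induce {v | v ∉ S}).Walk a b), X a ↔ X b := by
      intro a b q
      induction q with
      | nil => rfl
      | @cons u v _ h _ ih => exact (hX u v u.2 v.2 h).trans ih
    exact this _ _ p
  · intro h x y
    -- The test predicate is reachability from `x`.
    have := h (fun z => ∃ hz : z ∉ S, (G.induce {v | v ∉ S}).Reachable x ⟨z, hz⟩) (by
      intro a b ha hb hab
      have hadj : (G.induce {v | v ∉ S}).Adj ⟨a, ha⟩ ⟨b, hb⟩ := hab
      exact ⟨fun ⟨_, h⟩ => ⟨hb, h.trans hadj.reachable⟩,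
        fun ⟨_, h⟩ => ⟨ha, h.trans hadj.symm.reachable⟩⟩) x y x.2 y.2
    exact (this.1 ⟨x.2, .refl _⟩).2

/-- Since `κ < Fintype.card V`, fewer than `κ` deletions leave at least two vertices, so only
disconnection has to be excluded. -/
theorem vertexConnectivity_eq {V : Type*} [Fintype V] {G : SimpleGraph V} {κ : ℕ}
    (hcard : κ < Fintype.card V) (S : Finset V) (hS : S.card = κ)
    (hdis : ∃ X : V → Prop, (∀ x y, x ∉ S → y ∉ S → G.Adj x y → (X x ↔ X y)) ∧
      ∃ x y, x ∉ S ∧ y ∉ S ∧ X x ∧ ¬ X y)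
    (hcon : ∀ T : Finset V, T.card < κ →
      ∀ X : V → Prop, (∀ x y, x ∉ T → y ∉ T → G.Adj x y → (X x ↔ X y)) →
        ∀ x y, x ∉ T → y ∉ T → (X x ↔ X y)) :
    vertexConnectivity G = κ := by
  refine IsLeast.csInf_eq ⟨⟨S, hS, Or.inl ?_⟩, ?_⟩
  · rw [preconnected_induce_iff]
    obtain ⟨X, hX, x, y, hx, hy, h1, h2⟩ := hdis
    exact fun h => h2 ((h X hX x y hx hy).1 h1)
  · rintro m ⟨T, rfl, hT⟩
    by_contra hlt
    have hlt := not_le.1 hlt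
    rcases hT with hT | hT
    · exact hT (preconnected_induce_iff.2 (hcon T hlt))
    · omega

/-! ### Graphs and cycles in terms of natural numbers -/

/-- The graph on `Fin n` in which `i` and `j` are adjacent if they are distinct and related by `R`
in one of the two orders. -/
def natGraph (n : ℕ) (R : ℕ → ℕ → Prop) : SimpleGraph (Fin n) :=
  SimpleGraph.fromRel fun i j => R i j

theorem natGraph_adj {n : ℕ} {R : ℕ → ℕ → Prop} {i j : Fin n} :
    (natGraph n R).Adj i j ↔ (i : ℕ) ≠ j ∧ (R i j ∨ R j i) := by
  simp [natGraph, Fin.val_inj]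

theorem degree_natGraph {n : ℕ} {R : ℕ → ℕ → Prop} (i : Fin n)
    [Fintype ((natGraph n R).neighborSet i)] (s : Finset ℕ)
    (hs : ∀ j, j ∈ s ↔ j < n ∧ (i : ℕ) ≠ j ∧ (R i j ∨ R j i)) :
    (natGraph n R).degree i = s.card := by
  rw [← SimpleGraph.card_neighborFinset_eq_degree, ← Finset.card_map Fin.valEmbedding]
  congr 1
  ext j
  simp only [Finset.mem_map, SimpleGraph.mem_neighborFinset, natGraph_adj, Fin.valEmbedding_apply,
    hs]
  constructor
  · rintro ⟨a, h, rfl⟩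
    exact ⟨a.2, h⟩
  · rintro ⟨h1, h2⟩
    exact ⟨⟨j, h1⟩, h2, rfl⟩

/-- The analogue of `IsSpanningCycle` for relations between numbers less than `n`. -/
structure IsSpanningCycleRel (n : ℕ) (R e : ℕ → ℕ → Prop) : Prop where
  symm : ∀ a b, e a b → e b a
  rel : ∀ a b, e a b → a < n ∧ b < n ∧ a ≠ b ∧ (R a b ∨ R b a)
  two : ∀ x < n, ∃ y z, y ≠ z ∧ ∀ a, e x a ↔ a = y ∨ a = z
  cut : ∀ X : ℕ → Prop, (∀ a b, e a b → X a → X b) → ∀ a b, a < n → b < n → X a → X b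

/-- A set of edges on `Fin n`, read as a relation between numbers. -/
def edgeRel {n : ℕ} (E : Set (Sym2 (Fin n))) (a b : ℕ) : Prop :=
  ∃ (ha : a < n) (hb : b < n), s(⟨a, ha⟩, ⟨b, hb⟩) ∈ E

theorem edgeRel_val {n : ℕ} {E : Set (Sym2 (Fin n))} (a b : Fin n) :
    edgeRel E a b ↔ s(a, b) ∈ E :=
  ⟨fun ⟨_, _, h⟩ => h, fun h => ⟨a.2, b.2, h⟩⟩

theorem IsSpanningCycle.edgeRel {n : ℕ} {R : ℕ → ℕ → Prop} {E : Set (Sym2 (Fin n))}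
    (h : IsSpanningCycle (natGraph n R) E) : IsSpanningCycleRel n R (edgeRel E) := by
  refine ⟨?_, ?_, ?_, ?_⟩
  · rintro a b ⟨ha, hb, h⟩
    exact ⟨hb, ha, Sym2.eq_swap ▸ h⟩
  · rintro a b ⟨ha, hb, hab⟩
    exact ⟨ha, hb, natGraph_adj.1 (h.adj _ _ hab)⟩
  · intro x hx
    obtain ⟨y, z, hyz, h2⟩ := h.two ⟨x, hx⟩
    refine ⟨y, z, Fin.val_ne_of_ne hyz, fun a => ?_⟩
    constructor
    · rintro ⟨_, ha, h3⟩
      rcases (h2 _).1 h3 with h4 | h4 <;> simp [← h4]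
    · rintro (rfl | rfl)
      · exact (edgeRel_val ⟨x, hx⟩ y).2 ((h2 _).2 (.inl rfl))
      · exact (edgeRel_val ⟨x, hx⟩ z).2 ((h2 _).2 (.inr rfl))
  · intro X hX a b ha hb
    exact h.cut (fun i => X i) (fun i j hij => hX i j ((edgeRel_val i j).2 hij)) ⟨a, ha⟩ ⟨b, hb⟩

namespace IsSpanningCycleRel

variable {n : ℕ} {R e : ℕ → ℕ → Prop}

theorem two_of_three (h : IsSpanningCycleRel n R e) {x p q r : ℕ} (hx : x < n)
    (hpq : p ≠ q) (hpr : p ≠ r) (hqr : q ≠ r)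
    (hR : ∀ a < n, x ≠ a → R x a ∨ R a x → a = p ∨ a = q ∨ a = r) :
    (e x p ∧ e x q ∧ ¬ e x r) ∨ (e x p ∧ e x r ∧ ¬ e x q) ∨ (e x q ∧ e x r ∧ ¬ e x p) := by
  obtain ⟨y, z, hyz, h2⟩ := h.two x hx
  have hy := h.rel x y ((h2 y).2 (.inl rfl))
  have hz := h.rel x z ((h2 z).2 (.inr rfl))
  have hy := hR y hy.2.1 hy.2.2.1 hy.2.2.2
  have hz := hR z hz.2.1 hz.2.2.1 hz.2.2.2
  simp only [h2]
  omega

theorem and_of_not (h : IsSpanningCycleRel n R e) {x p q r : ℕ} (hr : ¬ e x r) (hx : x < n)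
    (hpq : p ≠ q) (hpr : p ≠ r) (hqr : q ≠ r)
    (hR : ∀ a < n, x ≠ a → R x a ∨ R a x → a = p ∨ a = q ∨ a = r) : e x p ∧ e x q := by
  rcases h.two_of_three hx hpq hpr hqr hR with ⟨h1, h2, -⟩ | ⟨-, h2, -⟩ | ⟨-, h2, -⟩
  · exact ⟨h1, h2⟩
  · exact (hr h2).elim
  · exact (hr h2).elim

theorem not_three (h : IsSpanningCycleRel n R e) {x p q r : ℕ} (hpq : p ≠ q) (hpr : p ≠ r)
    (hqr : q ≠ r) (hp : e x p) (hq : e x q) : ¬ e x r := by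
  obtain ⟨y, z, hyz, h2⟩ := h.two x (h.rel x p hp).1
  simp only [h2] at hp hq ⊢
  omega

end IsSpanningCycleRel

/-- `F` computes every edge from the status of the two edges `a b` and `c d`. It is enough to test
pairs with `R x y`, because each edge has this form in one of its orientations. -/
theorem injOn_edgeRel {n : ℕ} {R : ℕ → ℕ → Prop} (F : Prop → Prop → ℕ → ℕ → Prop)
    (a b c d : ℕ)
    (hF : ∀ e, IsSpanningCycleRel n R e → ∀ x y, x < n → y < n → R x y →
      (e x y ↔ F (e a b) (e c d) x y)) :
    Set.InjOn (fun E => (edgeRel E a b, edgeRel E c d)) (hamiltonianCycles (natGraph n R)) := by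
  intro E hE E' hE' heq
  have h := (isSpanningCycle_of_mem hE).edgeRel
  have h' := (isSpanningCycle_of_mem hE').edgeRel
  obtain ⟨h1, h2⟩ := Prod.mk.inj heq
  have key : ∀ x y, x < n → y < n → R x y → (edgeRel E x y ↔ edgeRel E' x y) := by
    intro x y hx hy hxy
    rw [hF _ h x y hx hy hxy, hF _ h' x y hx hy hxy, h1, h2]
  have key' : ∀ x y, edgeRel E x y ↔ edgeRel E' x y := by
    intro x y
    have hs : ∀ {e}, IsSpanningCycleRel n R e → (e x y ↔ e y x) := fun h =>
      ⟨h.symm x y, h.symm y x⟩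
    constructor
    · intro hxy
      obtain ⟨hx, hy, -, hr | hr⟩ := h.rel x y hxy
      · exact (key x y hx hy hr).1 hxy
      · exact (hs h').2 ((key y x hy hx hr).1 ((hs h).1 hxy))
    · intro hxy
      obtain ⟨hx, hy, -, hr | hr⟩ := h'.rel x y hxy
      · exact (key x y hx hy hr).2 hxy
      · exact (hs h).2 ((key y x hy hx hr).2 ((hs h').1 hxy))
  ext z
  induction z with
  | h x y => rw [← edgeRel_val, ← edgeRel_val, key']

theorem ncard_univ_prop_prod : (Set.univ : Set (Prop × Prop)).ncard = 4 := by
  rw [Set.ncard_univ, Nat.card_eq_fintype_card, Fintype.card_prod, Fintype.card_prop]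

theorem ncard_le_four {β : Type*} {s : Set β} {f : β → Prop × Prop} (h : s.InjOn f) :
    s.ncard ≤ 4 := by
  rw [← ncard_univ_prop_prod]
  exact Set.ncard_le_ncard_of_injOn f (fun _ _ => Set.mem_univ _) h (Set.toFinite _)

theorem ncard_eq_four {β : Type*} {s : Set β} {f : β → Prop × Prop} (h : s.InjOn f)
    (hsurj : ∀ p q, ∃ x ∈ s, f x = (p, q)) : s.ncard = 4 := by
  rw [← h.ncard_image, ← ncard_univ_prop_prod]
  congr 1
  refine Set.eq_univ_of_forall fun ⟨p, q⟩ => hsurj p q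

theorem exists_mem_hamiltonianCycles_natGraph {n : ℕ} {R : ℕ → ℕ → Prop} {m : ℕ} (hm : 2 ≤ m)
    (hn : n = m + 1) (f : ℕ → ℕ) (hlt : ∀ i ≤ m, f i < n)
    (hinj : ∀ i j, i ≤ m → j ≤ m → f i = f j → i = j)
    (hadj : ∀ i < m, R (f i) (f (i + 1)) ∨ R (f (i + 1)) (f i))
    (hlast : R (f m) (f 0) ∨ R (f 0) (f m)) :
    ∃ E ∈ hamiltonianCycles (natGraph n R), ∀ a b, edgeRel E a b ↔
      (∃ i < m, a = f i ∧ b = f (i + 1) ∨ a = f (i + 1) ∧ b = f i) ∨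
      (a = f m ∧ b = f 0 ∨ a = f 0 ∧ b = f m) := by
  have hn0 : 0 < n := by omega
  have : NeZero n := ⟨hn0.ne'⟩
  -- `Fin.ofNat` reduces modulo `n`, which changes nothing for indices up to `m`; later values of
  -- `f` play no role.
  have hval : ∀ i ≤ m, (Fin.ofNat n (f i) : ℕ) = f i := fun i hi => by
    simp [Nat.mod_eq_of_lt (hlt i hi)]
  obtain ⟨E, hE, h⟩ := exists_mem_hamiltonianCycles (G := natGraph n R) hm (by simp [hn])
    (fun i => Fin.ofNat n (f i))
    (fun i j hi hj hij => hinj i j hi hj (by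
      rw [← hval i hi, ← hval j hj, hij]))
    (fun i hi => by
      rw [natGraph_adj, hval i hi.le, hval (i + 1) hi]
      exact ⟨fun h => by have := hinj _ _ hi.le hi h; omega, hadj i hi⟩)
    (by
      rw [natGraph_adj, hval m le_rfl, hval 0 (by omega)]
      exact ⟨fun h => by have := hinj _ _ le_rfl (by omega) h; omega, hlast⟩)
  refine ⟨E, hE, fun a b => ?_⟩
  have hv : ∀ (x : Fin n) i, i ≤ m → (x = Fin.ofNat n (f i) ↔ (x : ℕ) = f i) := fun x i hi => by
    rw [← Fin.val_inj, hval i hi]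
  by_cases hab : a < n ∧ b < n
  · have := h ⟨a, hab.1⟩ ⟨b, hab.2⟩
    rw [← edgeRel_val] at this
    rw [this]
    simp only [hv _ m le_rfl, hv _ 0 (Nat.zero_le m)]
    refine or_congr (exists_congr fun i => and_congr_right fun hi => ?_) Iff.rfl
    simp only [hv _ i hi.le, hv _ (i + 1) hi]
  · refine ⟨fun ⟨h1, h2, _⟩ => (hab ⟨h1, h2⟩).elim, ?_⟩
    have h0 := hlt 0 (by omega)
    have h1 := hlt m le_rfl
    rintro (⟨i, hi, h⟩ | h)
    · have h2 := hlt i hi.le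
      have h3 := hlt (i + 1) hi
      omega
    · omega

/-- The connectivity of `natGraph n R`, in terms of numbers. -/
theorem vertexConnectivity_natGraph {n κ : ℕ} {R : ℕ → ℕ → Prop} (hn : κ < n) (S : Finset ℕ)
    (hS : S.card = κ) (hSn : ∀ x ∈ S, x < n)
    (hdis : ∃ X : ℕ → Prop, (∀ x y, x < n → y < n → x ∉ S → y ∉ S → R x y → (X x ↔ X y)) ∧
      ∃ x y, x < n ∧ y < n ∧ x ∉ S ∧ y ∉ S ∧ X x ∧ ¬ X y)
    (hcon : ∀ T : Finset ℕ, T.card < κ → ∀ X : ℕ → Prop,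
      (∀ x y, x < n → y < n → x ≠ y → x ∉ T → y ∉ T → R x y → (X x ↔ X y)) →
        ∀ x y, x < n → y < n → x ∉ T → y ∉ T → (X x ↔ X y)) :
    vertexConnectivity (natGraph n R) = κ := by
  have hmem : ∀ x : Fin n, x ∉ S.attachFin hSn ↔ (x : ℕ) ∉ S := by simp
  refine vertexConnectivity_eq (by simpa using hn) (S.attachFin hSn) (by simpa using hS) ?_ ?_
  · obtain ⟨X, hX, x, y, hx, hy, h1, h2, h3, h4⟩ := hdis
    refine ⟨fun i => X i, fun i j hi hj hij => ?_, ⟨x, hx⟩, ⟨y, hy⟩, (hmem _).2 h1, (hmem _).2 h2,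
      h3, h4⟩
    rw [hmem] at hi hj
    rcases (natGraph_adj.1 hij).2 with h | h
    · exact hX i j i.2 j.2 hi hj h
    · exact (hX j i j.2 i.2 hj hi h).symm
  · intro T hT X hX x y hx hy
    have hmem' : ∀ x : Fin n, (x : ℕ) ∉ T.map Fin.valEmbedding ↔ x ∉ T := by
      intro x
      simp [Fin.val_inj]
    have := hcon (T.map Fin.valEmbedding) (by simpa using hT) (fun i => ∃ hi : i < n, X ⟨i, hi⟩)
      (by
        intro a b ha hb hne h1 h2 hab
        have := hX ⟨a, ha⟩ ⟨b, hb⟩ ((hmem' ⟨a, ha⟩).1 h1) ((hmem' ⟨b, hb⟩).1 h2)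
          (natGraph_adj.2 ⟨hne, .inl hab⟩)
        simpa [ha, hb] using this)
      x y x.2 y.2 ((hmem' x).2 hx) ((hmem' y).2 hy)
    simpa using this

/-! ### Local configurations of a Hamiltonian cycle -/

namespace IsSpanningCycleRel

variable {n : ℕ} {R e : ℕ → ℕ → Prop}

theorem eq_or_eq (h : IsSpanningCycleRel n R e) {x p q r : ℕ} (hpq : p ≠ q)
    (hp : e x p) (hq : e x q) (hr : e x r) : r = p ∨ r = q := by
  obtain ⟨y, z, hyz, h2⟩ := h.two x (h.rel x p hp).1
  simp only [h2] at hp hq hr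
  omega

/-- A closed triangle uses both cycle edges at each of its vertices, so its vertex set is closed
under `e` and cannot miss `x`. -/
theorem no_triangle (h : IsSpanningCycleRel n R e) {a b c x : ℕ} (hab : e a b) (hbc : e b c)
    (hca : e c a) (hx : x < n) (hxa : x ≠ a) (hxb : x ≠ b) (hxc : x ≠ c) : False := by
  have h1 := h.rel _ _ hab
  have h2 := h.rel _ _ hbc
  have h3 := h.rel _ _ hca
  have := h.cut (fun y => y = a ∨ y = b ∨ y = c) (by
    rintro y z hyz (rfl | rfl | rfl)
    · have := h.eq_or_eq h2.2.2.1 hab (h.symm _ _ hca) hyz; omega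
    · have := h.eq_or_eq h3.2.2.1.symm (h.symm _ _ hab) hbc hyz; omega
    · have := h.eq_or_eq h1.2.2.1 hca (h.symm _ _ hbc) hyz; omega) a x h1.1 hx (.inl rfl)
  omega

theorem no_square (h : IsSpanningCycleRel n R e) {a b c d x : ℕ} (hab : e a b) (hbc : e b c)
    (hcd : e c d) (hda : e d a) (hac : a ≠ c) (hbd : b ≠ d) (hx : x < n) (hxa : x ≠ a)
    (hxb : x ≠ b) (hxc : x ≠ c) (hxd : x ≠ d) : False := by
  have h1 := h.rel _ _ hab
  have := h.cut (fun y => y = a ∨ y = b ∨ y = c ∨ y = d) (by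
    rintro y z hyz (rfl | rfl | rfl | rfl)
    · have := h.eq_or_eq hbd hab (h.symm _ _ hda) hyz; omega
    · have := h.eq_or_eq hac (h.symm _ _ hab) hbc hyz; omega
    · have := h.eq_or_eq hbd (h.symm _ _ hbc) hcd hyz; omega
    · have := h.eq_or_eq hac hda (h.symm _ _ hcd) hyz; omega) a x h1.1 hx (.inl rfl)
  omega

/-- A triangle `a b c` in which `a` and `b` have the third neighbour `v`, and `c` the third
neighbour `d`, is traversed from `v` to `d` in one of the two possible ways. -/
theorem triangle_end (h : IsSpanningCycleRel n R e) {a b c d v : ℕ} (ha : a < n) (hb : b < n)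
    (hc : c < n) (hd : d < n) (hne : [a, b, c, d, v].Nodup)
    (hRa : ∀ y < n, a ≠ y → R a y ∨ R y a → y = b ∨ y = c ∨ y = v)
    (hRb : ∀ y < n, b ≠ y → R b y ∨ R y b → y = a ∨ y = c ∨ y = v)
    (hRc : ∀ y < n, c ≠ y → R c y ∨ R y c → y = a ∨ y = b ∨ y = d) :
    e c d ∧ e a b ∧ (e a v ↔ ¬ e a c) ∧ (e b v ↔ e a c) ∧ (e b c ↔ ¬ e a c) := by
  simp only [List.nodup_cons, List.mem_cons, List.not_mem_nil, or_false, not_or] at hne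
  have ta := h.two_of_three ha (by omega) (by omega) (by omega) hRa
  have tb := h.two_of_three hb (by omega) (by omega) (by omega) hRb
  have tc := h.two_of_three hc (by omega) (by omega) (by omega) hRc
  -- Both closed circuits miss `d`. Omitting `c d` would close the triangle or the square; omitting
  -- `a b` would close the square `a c b v`.
  have n1 : e a b → e b c → e c a → False := fun h1 h2 h3 =>
    h.no_triangle h1 h2 h3 hd (by omega) (by omega) (by omega)
  have n2 : e a c → e c b → e b v → e v a → False := fun h1 h2 h3 h4 =>
    h.no_square h1 h2 h3 h4 (by omega) (by omega) hd (by omega) (by omega) (by omega) (by omega)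
  have hs : ∀ x y, e x y ↔ e y x := fun x y => ⟨h.symm x y, h.symm y x⟩
  rw [hs b a] at tb
  rw [hs c a, hs c b] at tc
  rw [hs c a] at n1
  rw [hs c b, hs v a] at n2
  clear hne hRa hRb hRc hs h ha hb hc hd
  grind

end IsSpanningCycleRel

/-! ### The dumbbell: four cycles on `2 * k + 4` vertices -/

/-- Two triangles joined by a path through the vertices `2, …, 2 * k`, together with the vertex
`2 * k + 3`, which is adjacent to all others except `2` and `2 * k`. -/
def dumbbellRel (k a b : ℕ) : Prop :=
  (b = a + 1 ∧ b ≤ 2 * k + 2) ∨ (a = 0 ∧ b = 2) ∨ (a = 2 * k ∧ b = 2 * k + 2) ∨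
    (b = 2 * k + 3 ∧ a ≤ 2 * k + 2 ∧ a ≠ 2 ∧ a ≠ 2 * k)

theorem injOn_dumbbell {k : ℕ} (hk : 2 ≤ k) :
    Set.InjOn (fun E => (edgeRel E 0 2, edgeRel E (2 * k + 2) (2 * k)))
      (hamiltonianCycles (natGraph (2 * k + 4) (dumbbellRel k))) := by
  refine injOn_edgeRel (fun α β x y =>
    (y = 2 * k + 3 ∧ ((x = 0 ∧ ¬ α) ∨ (x = 1 ∧ α) ∨ (x = 2 * k + 1 ∧ β) ∨
      (x = 2 * k + 2 ∧ ¬ β))) ∨ (y = x + 1 ∧ x ≠ 1 ∧ x ≠ 2 * k ∧ y ≤ 2 * k + 2) ∨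
    (x = 0 ∧ y = 2 ∧ α) ∨ (x = 1 ∧ y = 2 ∧ ¬ α) ∨ (x = 2 * k ∧ y = 2 * k + 2 ∧ β) ∨
    (x = 2 * k ∧ y = 2 * k + 1 ∧ ¬ β)) _ _ _ _ ?_
  intro e h x y hx hy hxy
  obtain ⟨l1, l2, l3, l4, l5⟩ := h.triangle_end (a := 0) (b := 1) (c := 2) (d := 3)
    (v := 2 * k + 3) (by omega) (by omega) (by omega) (by omega)
    (by simp; omega) (by unfold dumbbellRel; omega) (by unfold dumbbellRel; omega)
    (by unfold dumbbellRel; omega)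
  obtain ⟨r1, r2, r3, r4, r5⟩ := h.triangle_end (a := 2 * k + 2) (b := 2 * k + 1) (c := 2 * k)
    (d := 2 * k - 1) (v := 2 * k + 3) (by omega) (by omega) (by omega) (by omega)
    (by simp; omega) (by unfold dumbbellRel; omega) (by unfold dumbbellRel; omega)
    (by unfold dumbbellRel; omega)
  have hs : ∀ x y, e x y ↔ e y x := fun x y => ⟨h.symm x y, h.symm y x⟩
  -- The hub already has one cycle edge from each triangle.
  have hv : ∀ i, 3 ≤ i → i < 2 * k → ¬ e i (2 * k + 3) := by
    intro i hi1 hi2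
    rw [hs]
    by_cases hα : e 0 2 <;> by_cases hβ : e (2 * k + 2) (2 * k) <;>
      simp only [hα, hβ, not_true_eq_false, not_false_eq_true, iff_true, iff_false] at l3 l4 r3 r4
    · exact h.not_three (by omega) (by omega) (by omega) ((hs _ _).1 l4) ((hs _ _).1 r4)
    · exact h.not_three (by omega) (by omega) (by omega) ((hs _ _).1 l4) ((hs _ _).1 r3)
    · exact h.not_three (by omega) (by omega) (by omega) ((hs _ _).1 l3) ((hs _ _).1 r4)
    · exact h.not_three (by omega) (by omega) (by omega) ((hs _ _).1 l3) ((hs _ _).1 r3)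
  have hp : ∀ i, 2 ≤ i → i < 2 * k → e i (i + 1) := by
    intro i hi1 hi2
    obtain rfl | hi := hi1.eq_or_lt
    · exact l1
    exact (h.and_of_not (p := i - 1) (hv i hi hi2) (by omega) (by omega) (by omega) (by omega)
      (by unfold dumbbellRel; omega)).2
  have hcases : (x = 0 ∧ y = 1) ∨ (x = 0 ∧ y = 2) ∨ (x = 1 ∧ y = 2) ∨
      (x = 2 * k ∧ y = 2 * k + 1) ∨ (x = 2 * k ∧ y = 2 * k + 2) ∨
      (x = 2 * k + 1 ∧ y = 2 * k + 2) ∨ (2 ≤ x ∧ x < 2 * k ∧ y = x + 1) ∨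
      (y = 2 * k + 3 ∧ (x = 0 ∨ x = 1 ∨ x = 2 * k + 1 ∨ x = 2 * k + 2 ∨ 3 ≤ x ∧ x < 2 * k)) := by
    unfold dumbbellRel at hxy
    grind
  rw [hs (2 * k + 2) (2 * k + 1)] at r2
  rw [hs (2 * k + 1) (2 * k)] at r5
  have r6 := hs (2 * k + 2) (2 * k)
  rcases hcases with ⟨rfl, rfl⟩ | ⟨rfl, rfl⟩ | ⟨rfl, rfl⟩ | ⟨rfl, rfl⟩ | ⟨rfl, rfl⟩ | ⟨rfl, rfl⟩ |
    ⟨h1, h2, rfl⟩ | ⟨rfl, rfl | rfl | rfl | rfl | ⟨h1, h2⟩⟩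
  · simp only [l2]; grind
  · generalize e 0 2 = p; grind
  · rw [l5]; generalize e 0 2 = p; grind
  · rw [r5]; generalize e (2 * k + 2) (2 * k) = p; grind
  · rw [← r6]; generalize e (2 * k + 2) (2 * k) = p; grind
  · simp only [r2]; grind
  · simp only [hp x h1 h2]; grind
  · rw [l3]; generalize e 0 2 = p; grind
  · rw [l4]; generalize e 0 2 = p; grind
  · rw [r4]; generalize e (2 * k + 2) (2 * k) = p; grind
  · rw [r3]; generalize e (2 * k + 2) (2 * k) = p; grind
  · simp only [hv x h1 h2]; grind

/-- Coding a proposition as 0 or 1 lets one arithmetic formula enumerate all four cycles. -/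
theorem exists_le_one_iff (p : Prop) : ∃ a : ℕ, a ≤ 1 ∧ (p ↔ a = 0) := by
  by_cases hp : p
  · exact ⟨0, by omega, by simpa using hp⟩
  · exact ⟨1, le_rfl, by simpa using hp⟩

theorem exists_dumbbell {k : ℕ} (hk : 2 ≤ k) (α β : Prop) :
    ∃ E ∈ hamiltonianCycles (natGraph (2 * k + 4) (dumbbellRel k)),
      (edgeRel E 0 2, edgeRel E (2 * k + 2) (2 * k)) = (α, β) := by
  obtain ⟨A, hA1, hA⟩ := exists_le_one_iff α
  obtain ⟨B, hB1, hB⟩ := exists_le_one_iff β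
  -- The cycle is hub, `1 - A`, `A`, `2, …, 2 * k`, `2 * k + 2 - B`, `2 * k + 1 + B`; `A` and `B`
  -- choose the orders in which the triangles are traversed.
  obtain ⟨f, hf⟩ : ∃ f : ℕ → ℕ, ∀ i, (i = 0 ∧ f i = 2 * k + 3) ∨ (i = 1 ∧ f i = 1 - A) ∨
      (i = 2 ∧ f i = A) ∨ (3 ≤ i ∧ i ≤ 2 * k + 1 ∧ f i = i - 1) ∨
      (i = 2 * k + 2 ∧ f i = 2 * k + 2 - B) ∨ (2 * k + 3 ≤ i ∧ f i = 2 * k + 1 + B) := by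
    refine ⟨fun i => if i = 0 then 2 * k + 3 else if i = 1 then 1 - A else if i = 2 then A else
      if i ≤ 2 * k + 1 then i - 1 else if i = 2 * k + 2 then 2 * k + 2 - B else 2 * k + 1 + B,
      fun i => ?_⟩
    dsimp only
    split_ifs <;> omega
  have f0 : f 0 = 2 * k + 3 := by have := hf 0; omega
  have fm : f (2 * k + 3) = 2 * k + 1 + B := by have := hf (2 * k + 3); omega
  obtain ⟨E, hE, h⟩ := exists_mem_hamiltonianCycles_natGraph (n := 2 * k + 4)
    (R := dumbbellRel k) (m := 2 * k + 3) (by omega) rfl f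
    (fun i hi => by have := hf i; omega)
    (fun i j hi hj hij => by have := hf i; have := hf j; omega)
    (fun i hi => by
      have h1 := hf i; have h2 := hf (i + 1)
      clear hf hA hB
      unfold dumbbellRel
      generalize f i = a at *
      generalize f (i + 1) = b at *
      grind (splits := 30))
    (by rw [f0, fm]; unfold dumbbellRel; omega)
  refine ⟨E, hE, Prod.mk.injEq .. ▸ ⟨propext ?_, propext ?_⟩⟩
  · rw [h, hA]
    constructor
    · rintro (⟨i, hi, h⟩ | h)
      · have := hf i; have := hf (i + 1); omega
      · omega
    · intro hA
      exact .inl ⟨2, by omega, by have := hf 2; have := hf (2 + 1); omega⟩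
  · rw [h, hB]
    constructor
    · rintro (⟨i, hi, h⟩ | h)
      · have := hf i; have := hf (i + 1); omega
      · omega
    · intro hB
      exact .inl ⟨2 * k + 1, by omega, by
        have := hf (2 * k + 1); have := hf (2 * k + 1 + 1); omega⟩

theorem numHamiltonianCycles_dumbbell {k : ℕ} (hk : 2 ≤ k) :
    numHamiltonianCycles (natGraph (2 * k + 4) (dumbbellRel k)) = 4 :=
  ncard_eq_four (injOn_dumbbell hk) (exists_dumbbell hk)

theorem isBiregular_dumbbell {k : ℕ} (hk : 2 ≤ k) :
    IsBiregular (natGraph (2 * k + 4) (dumbbellRel k)) 3 (2 * k + 1) := by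
  classical
  have hv : (natGraph (2 * k + 4) (dumbbellRel k)).degree ⟨2 * k + 3, by omega⟩ = 2 * k + 1 := by
    rw [degree_natGraph _ (((Finset.range (2 * k + 3)).erase 2).erase (2 * k)) (fun j => by
      simp only [Finset.mem_erase, Finset.mem_range]
      unfold dumbbellRel; omega)]
    rw [Finset.card_erase_of_mem, Finset.card_erase_of_mem, Finset.card_range]
    · omega
    · simp
    · simp; omega
  have hlow : ∀ i : Fin (2 * k + 4), (i : ℕ) ≠ 2 * k + 3 →
      (natGraph (2 * k + 4) (dumbbellRel k)).degree i = 3 := by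
    intro i hi
    have hi' := i.2
    obtain ⟨p, q, r, h⟩ : ∃ p q r, p ≠ q ∧ p ≠ r ∧ q ≠ r ∧ ∀ j, (j = p ∨ j = q ∨ j = r) ↔
        j < 2 * k + 4 ∧ (i : ℕ) ≠ j ∧ (dumbbellRel k i j ∨ dumbbellRel k j i) := by
      unfold dumbbellRel
      rcases (by omega : (i : ℕ) = 0 ∨ (i : ℕ) = 1 ∨ (i : ℕ) = 2 ∨ (i : ℕ) = 2 * k ∨
        (i : ℕ) = 2 * k + 1 ∨ (i : ℕ) = 2 * k + 2 ∨ (3 ≤ (i : ℕ) ∧ (i : ℕ) < 2 * k)) with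
        h | h | h | h | h | h | h
      · exact ⟨1, 2, 2 * k + 3, by omega, by omega, by omega, by omega⟩
      · exact ⟨0, 2, 2 * k + 3, by omega, by omega, by omega, by omega⟩
      · exact ⟨0, 1, 3, by omega, by omega, by omega, by omega⟩
      · exact ⟨2 * k - 1, 2 * k + 1, 2 * k + 2, by omega, by omega, by omega, by omega⟩
      · exact ⟨2 * k, 2 * k + 2, 2 * k + 3, by omega, by omega, by omega, by omega⟩
      · exact ⟨2 * k, 2 * k + 1, 2 * k + 3, by omega, by omega, by omega, by omega⟩
      · exact ⟨i - 1, i + 1, 2 * k + 3, by omega, by omega, by omega, by omega⟩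
    rw [degree_natGraph _ {p, q, r} (fun j => by simpa using h.2.2.2 j)]
    exact Finset.card_eq_three.2 ⟨p, q, r, h.1, h.2.1, h.2.2.1, rfl⟩
  refine ⟨fun i => ?_, ⟨⟨0, by omega⟩, ?_⟩, ⟨⟨2 * k + 3, by omega⟩, ?_⟩⟩
  · by_cases hi : (i : ℕ) = 2 * k + 3
    · right
      convert hv
    · left
      convert hlow i hi
  · convert hlow ⟨0, by omega⟩ (by simp)
  · convert hv

/-- A predicate that does not change along the edges of a path is constant on the path. -/
theorem iff_of_forall_succ {X : ℕ → Prop} {a b : ℕ} (hab : a ≤ b)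
    (h : ∀ i, a ≤ i → i < b → (X i ↔ X (i + 1))) : X a ↔ X b := by
  induction b, hab using Nat.le_induction with
  | base => rfl
  | succ b hb ih => exact (ih fun i h1 h2 => h i h1 (by omega)).trans (h b hb (by omega))

theorem vertexConnectivity_dumbbell {k : ℕ} (hk : 2 ≤ k) :
    vertexConnectivity (natGraph (2 * k + 4) (dumbbellRel k)) = 2 := by
  refine vertexConnectivity_natGraph (by omega) {2, 2 * k + 3} ?_ ?_ ?_ ?_
  · exact Finset.card_pair (by omega)
  · simp
  · refine ⟨fun x => x < 2, fun x y hx hy => ?_, 0, 3, ?_⟩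
    · simp only [Finset.mem_insert, Finset.mem_singleton]
      unfold dumbbellRel
      omega
    · simp; omega
  · intro T hT X hX
    have hone : ∀ x y, x ≠ y → x ∉ T ∨ y ∉ T := by
      intro x y hxy
      by_contra! h
      exact hxy (Finset.card_le_one.1 (by omega) x h.1 y h.2)
    suffices h : ∃ p : Prop, ∀ x, x < 2 * k + 4 → x ∉ T → (X x ↔ p) by
      obtain ⟨p, h⟩ := h
      exact fun x y hx hy hxT hyT => (h x hx hxT).trans (h y hy hyT).symm
    -- Without the hub the path `0, …, 2 * k + 2` remains. With it, only `2` and `2 * k` are not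
    -- adjacent to it, and each has two neighbours in its triangle that are, one of which survives.
    by_cases hv : 2 * k + 3 ∈ T
    · refine ⟨X 0, fun x hx hxT => ?_⟩
      have hT : ∀ i, i < 2 * k + 3 → i ∉ T := fun i hi =>
        (hone i (2 * k + 3) (by omega)).resolve_right (not_not.2 hv)
      have hx' : x < 2 * k + 3 := by
        rcases (by omega : x < 2 * k + 3 ∨ x = 2 * k + 3) with h | rfl
        · exact h
        · exact (hxT hv).elim
      exact (iff_of_forall_succ (Nat.zero_le x) fun i _ hi =>
        hX i (i + 1) (by omega) (by omega) (by omega) (hT _ (by omega)) (hT _ (by omega))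
          (by unfold dumbbellRel; omega)).symm
    · refine ⟨X (2 * k + 3), fun x hx hxT => ?_⟩
      have hdir : ∀ x, x < 2 * k + 3 → x ≠ 2 → x ≠ 2 * k → x ∉ T → (X x ↔ X (2 * k + 3)) :=
        fun x hx h1 h2 hxT => hX x _ (by omega) (by omega) (by omega) hxT hv
          (by unfold dumbbellRel; omega)
      rcases (by omega : x = 2 * k + 3 ∨ x = 2 ∨ x = 2 * k ∨ (x < 2 * k + 3 ∧ x ≠ 2 ∧ x ≠ 2 * k))
        with rfl | rfl | rfl | ⟨h1, h2, h3⟩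
      · rfl
      · rcases hone 0 1 (by omega) with h | h
        · exact (hX 0 2 (by omega) (by omega) (by omega) h hxT (by unfold dumbbellRel; omega)).symm.trans
            (hdir 0 (by omega) (by omega) (by omega) h)
        · exact (hX 1 2 (by omega) (by omega) (by omega) h hxT (by unfold dumbbellRel; omega)).symm.trans
            (hdir 1 (by omega) (by omega) (by omega) h)
      · rcases hone (2 * k + 1) (2 * k + 2) (by omega) with h | h
        · exact (hX (2 * k) _ (by omega) (by omega) (by omega) hxT h (by unfold dumbbellRel; omega)).trans
            (hdir _ (by omega) (by omega) (by omega) h)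
        · exact (hX (2 * k) _ (by omega) (by omega) (by omega) hxT h (by unfold dumbbellRel; omega)).trans
            (hdir _ (by omega) (by omega) (by omega) h)
      · exact hdir x h1 h2 h3 hxT

/-! ### The join: four cycles on six vertices -/

/-- The join of two adjacent vertices `4`, `5` with the disjoint edges `0 1` and `2 3`. -/
def joinRel (a b : ℕ) : Prop :=
  (a = 0 ∧ b = 1) ∨ (a = 2 ∧ b = 3) ∨ (b = 4 ∧ a < 4) ∨ (b = 5 ∧ a < 5)

instance (a b : ℕ) : Decidable (joinRel a b) := by unfold joinRel; infer_instance

instance : DecidableRel (natGraph 6 joinRel).Adj := fun _ _ =>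
  decidable_of_iff _ natGraph_adj.symm

/-- If `a` and `b` have no neighbours other than each other and `u`, `v`, and there is a further
vertex `x`, then the edge `a b` is used, and continued to `u` on one side and to `v` on the
other. -/
theorem IsSpanningCycleRel.edge_join {n : ℕ} {R e : ℕ → ℕ → Prop} (h : IsSpanningCycleRel n R e)
    {a b u v x : ℕ} (ha : a < n) (hb : b < n) (hx : x < n) (hne : [a, b, u, v, x].Nodup)
    (hRa : ∀ y < n, a ≠ y → R a y ∨ R y a → y = b ∨ y = u ∨ y = v)
    (hRb : ∀ y < n, b ≠ y → R b y ∨ R y b → y = a ∨ y = u ∨ y = v) :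
    e a b ∧ (e a v ↔ ¬ e a u) ∧ (e b u ↔ ¬ e a u) ∧ (e b v ↔ e a u) := by
  simp only [List.nodup_cons, List.mem_cons, List.not_mem_nil, or_false, not_or] at hne
  have ta := h.two_of_three ha (by omega) (by omega) (by omega) hRa
  have tb := h.two_of_three hb (by omega) (by omega) (by omega) hRb
  -- All three circuits miss `x`. The square excludes omitting `a b`; the triangles exclude leaving
  -- `a` and `b` through the same vertex.
  have n1 : e a b → e b u → e u a → False := fun h1 h2 h3 =>
    h.no_triangle h1 h2 h3 hx (by omega) (by omega) (by omega)
  have n2 : e a b → e b v → e v a → False := fun h1 h2 h3 =>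
    h.no_triangle h1 h2 h3 hx (by omega) (by omega) (by omega)
  have n3 : e a u → e u b → e b v → e v a → False := fun h1 h2 h3 h4 =>
    h.no_square h1 h2 h3 h4 (by omega) (by omega) hx (by omega) (by omega) (by omega) (by omega)
  have hs : ∀ x y, e x y ↔ e y x := fun x y => ⟨h.symm x y, h.symm y x⟩
  rw [hs b a] at tb
  rw [hs u a] at n1
  rw [hs v a] at n2 n3
  rw [hs u b] at n3
  clear hne hRa hRb hs h ha hb hx
  grind

theorem injOn_join :
    Set.InjOn (fun E => (edgeRel E 0 4, edgeRel E 2 4)) (hamiltonianCycles (natGraph 6 joinRel)) := by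
  refine injOn_edgeRel (fun α β x y =>
    (x = 0 ∧ y = 1) ∨ (x = 2 ∧ y = 3) ∨ (x = 0 ∧ y = 4 ∧ α) ∨ (x = 0 ∧ y = 5 ∧ ¬ α) ∨
    (x = 1 ∧ y = 4 ∧ ¬ α) ∨ (x = 1 ∧ y = 5 ∧ α) ∨ (x = 2 ∧ y = 4 ∧ β) ∨ (x = 2 ∧ y = 5 ∧ ¬ β) ∨
    (x = 3 ∧ y = 4 ∧ ¬ β) ∨ (x = 3 ∧ y = 5 ∧ β)) _ _ _ _ ?_
  intro e h x y hx hy hxy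
  obtain ⟨l1, l2, l3, l4⟩ := h.edge_join (a := 0) (b := 1) (u := 4) (v := 5) (x := 2)
    (by omega) (by omega) (by omega) (by decide) (by decide) (by decide)
  obtain ⟨r1, r2, r3, r4⟩ := h.edge_join (a := 2) (b := 3) (u := 4) (v := 5) (x := 0)
    (by omega) (by omega) (by omega) (by decide) (by decide) (by decide)
  -- Vertex `4` already has a cycle edge from each of the pairs `0 1` and `2 3`.
  have h45 : ¬ e 4 5 := by
    obtain ⟨i, hi, hi4⟩ : ∃ i < 2, e i 4 := by
      by_cases h0 : e 0 4
      · exact ⟨0, by omega, h0⟩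
      · exact ⟨1, by omega, l3.2 h0⟩
    obtain ⟨j, hj, hj4⟩ : ∃ j, (2 ≤ j ∧ j < 4) ∧ e j 4 := by
      by_cases h0 : e 2 4
      · exact ⟨2, by omega, h0⟩
      · exact ⟨3, by omega, r3.2 h0⟩
    exact h.not_three (by omega) (by omega) (by omega) (h.symm _ _ hi4) (h.symm _ _ hj4)
  clear h hx hy
  unfold joinRel at hxy
  rcases hxy with ⟨rfl, rfl⟩ | ⟨rfl, rfl⟩ | ⟨rfl, hx⟩ | ⟨rfl, hx⟩
  · simpa using l1
  · simpa using r1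
  all_goals interval_cases x <;> simp [*]

theorem exists_join (α β : Prop) :
    ∃ E ∈ hamiltonianCycles (natGraph 6 joinRel), (edgeRel E 0 4, edgeRel E 2 4) = (α, β) := by
  obtain ⟨A, hA1, hA⟩ := exists_le_one_iff α
  obtain ⟨B, hB1, hB⟩ := exists_le_one_iff β
  -- The cycle is `4, A, 1 - A, 5, 3 - B, 2 + B`, so `B` decides its closing edge.
  obtain ⟨f, hf⟩ : ∃ f : ℕ → ℕ, f 0 = 4 ∧ f 1 = A ∧ f 2 = 1 - A ∧ f 3 = 5 ∧ f 4 = 3 - B ∧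
      f 5 = 2 + B :=
    ⟨fun i => [4, A, 1 - A, 5, 3 - B, 2 + B].getD i 0, rfl, rfl, rfl, rfl, rfl, rfl⟩
  obtain ⟨f0, f1, f2, f3, f4, f5⟩ := hf
  obtain ⟨E, hE, h⟩ := exists_mem_hamiltonianCycles_natGraph (n := 6) (R := joinRel) (m := 5)
    (by omega) rfl f (fun i hi => by interval_cases i <;> omega)
    (fun i j hi hj hij => by interval_cases i <;> interval_cases j <;> omega)
    (fun i hi => by unfold joinRel; interval_cases i <;> simp only [zero_add, Nat.reduceAdd] <;> omega)
    (by unfold joinRel; omega)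
  refine ⟨E, hE, Prod.mk.injEq .. ▸ ⟨propext ?_, propext ?_⟩⟩
  · rw [h, hA]
    constructor
    · rintro (⟨i, hi, h⟩ | h)
      · interval_cases i <;> simp only [zero_add, Nat.reduceAdd] at h <;> omega
      · omega
    · intro hA
      exact .inl ⟨0, by omega, by rw [zero_add]; omega⟩
  · rw [h, hB]
    constructor
    · rintro (⟨i, hi, h⟩ | h)
      · interval_cases i <;> simp only [zero_add, Nat.reduceAdd] at h <;> omega
      · omega
    · intro hB
      exact .inr (by omega)

theorem numHamiltonianCycles_join : numHamiltonianCycles (natGraph 6 joinRel) = 4 :=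
  ncard_eq_four injOn_join exists_join

theorem isBiregular_join : IsBiregular (natGraph 6 joinRel) 3 5 := by
  have h : ∀ i, (natGraph 6 joinRel).degree i = if i < 4 then 3 else 5 := by decide
  refine ⟨fun i => ?_, ⟨0, ?_⟩, ⟨4, ?_⟩⟩
  · by_cases hi : i < 4
    · left; convert (h i).trans (if_pos hi)
    · right; convert (h i).trans (if_neg hi)
  · convert (h 0).trans (if_pos (by decide))
  · convert (h 4).trans (if_neg (by decide))

theorem vertexConnectivity_join : vertexConnectivity (natGraph 6 joinRel) = 2 := by
  refine vertexConnectivity_natGraph (by omega) {4, 5} (by decide) (by decide) ?_ ?_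
  · refine ⟨fun x => x < 2, fun x y hx hy => ?_, 0, 2, by decide⟩
    simp only [Finset.mem_insert, Finset.mem_singleton]
    unfold joinRel
    omega
  · intro T hT X hX
    have hone : 4 ∉ T ∨ 5 ∉ T := by
      by_contra! h
      have := Finset.card_le_one.1 (by omega) 4 h.1 5 h.2
      omega
    obtain ⟨c, hcT, hc⟩ : ∃ c, c ∉ T ∧ (c = 4 ∨ c = 5) := by
      rcases hone with h | h
      · exact ⟨4, h, .inl rfl⟩
      · exact ⟨5, h, .inr rfl⟩
    have key : ∀ x, x < 6 → x ∉ T → (X x ↔ X c) := by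
      intro x hx hxT
      rcases lt_trichotomy x c with h | rfl | h
      · exact hX x c hx (by omega) (by omega) hxT hcT (by unfold joinRel; omega)
      · rfl
      · exact (hX c x (by omega) hx (by omega) hcT hxT (by unfold joinRel; omega)).symm
    exact fun x y hx hy hxT hyT => (key x hx hxT).trans (key y hy hyT).symm

/-! ### The three-hub graph of connectivity 3 -/

/-- A path on the vertices `0, …, 4 * j + 2`, two further vertices `4 * j + 3` and `4 * j + 4`, and
three vertices `4 * j + 5`, `4 * j + 6`, `4 * j + 7` whose removal separates these three parts. -/
def threeHubRel (j a b : ℕ) : Prop :=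
  (b = a + 1 ∧ b ≤ 4 * j + 2) ∨ ((a = 0 ∨ a = 4 * j + 2) ∧ (b = 4 * j + 6 ∨ b = 4 * j + 7)) ∨
    (a = 1 ∧ b = 4 * j + 5) ∨ (2 ≤ a ∧ a ≤ 2 * j + 1 ∧ b = 4 * j + 6) ∨
    (2 * j + 2 ≤ a ∧ a ≤ 4 * j + 1 ∧ b = 4 * j + 7) ∨
    ((a = 4 * j + 3 ∨ a = 4 * j + 4) ∧ (b = 4 * j + 5 ∨ b = 4 * j + 6 ∨ b = 4 * j + 7)) ∨
    (a = 4 * j + 6 ∧ b = 4 * j + 7)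

/-- The neighbours of the vertices of degree three. -/
theorem threeHubRel_iff {j x p q r : ℕ}
    (h : (x = 0 ∧ p = 1 ∧ q = 4 * j + 6 ∧ r = 4 * j + 7) ∨
      (x = 1 ∧ p = 0 ∧ q = 2 ∧ r = 4 * j + 5) ∨
      (2 ≤ x ∧ x ≤ 2 * j + 1 ∧ p = x - 1 ∧ q = x + 1 ∧ r = 4 * j + 6) ∨
      (2 * j + 2 ≤ x ∧ x ≤ 4 * j + 1 ∧ p = x - 1 ∧ q = x + 1 ∧ r = 4 * j + 7) ∨
      (x = 4 * j + 2 ∧ p = 4 * j + 1 ∧ q = 4 * j + 6 ∧ r = 4 * j + 7) ∨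
      ((x = 4 * j + 3 ∨ x = 4 * j + 4) ∧ p = 4 * j + 5 ∧ q = 4 * j + 6 ∧ r = 4 * j + 7) ∨
      (x = 4 * j + 5 ∧ p = 1 ∧ q = 4 * j + 3 ∧ r = 4 * j + 4)) (y : ℕ) :
    (y = p ∨ y = q ∨ y = r) ↔ y < 4 * j + 8 ∧ x ≠ y ∧ (threeHubRel j x y ∨ threeHubRel j y x) := by
  constructor
  · intro hy
    refine ⟨by omega, by omega, ?_⟩
    unfold threeHubRel
    rcases h with ⟨rfl, rfl, rfl, rfl⟩ | ⟨rfl, rfl, rfl, rfl⟩ | ⟨h1, h2, rfl, rfl, rfl⟩ |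
      ⟨h1, h2, rfl, rfl, rfl⟩ | ⟨rfl, rfl, rfl, rfl⟩ | ⟨rfl | rfl, rfl, rfl, rfl⟩ |
      ⟨rfl, rfl, rfl, rfl⟩ <;> rcases hy with rfl | rfl | rfl <;>
    first
      | exact .inl (.inl ⟨by omega, by omega⟩)
      | exact .inl (.inr (.inl ⟨by omega, by omega⟩))
      | exact .inl (.inr (.inr (.inl ⟨by omega, by omega⟩)))
      | exact .inl (.inr (.inr (.inr (.inl ⟨by omega, by omega, by omega⟩))))
      | exact .inl (.inr (.inr (.inr (.inr (.inl ⟨by omega, by omega, by omega⟩)))))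
      | exact .inl (.inr (.inr (.inr (.inr (.inr (.inl ⟨by omega, by omega⟩))))))
      | exact .inr (.inl ⟨by omega, by omega⟩)
      | exact .inr (.inr (.inr (.inl ⟨by omega, by omega⟩)))
      | exact .inr (.inr (.inr (.inr (.inr (.inr (.inl ⟨by omega, by omega⟩))))))
  · rintro ⟨hy, hxy, h' | h'⟩ <;>
    rcases h with ⟨rfl, rfl, rfl, rfl⟩ | ⟨rfl, rfl, rfl, rfl⟩ | ⟨h1, h2, rfl, rfl, rfl⟩ |
      ⟨h1, h2, rfl, rfl, rfl⟩ | ⟨rfl, rfl, rfl, rfl⟩ | ⟨rfl | rfl, rfl, rfl, rfl⟩ |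
      ⟨rfl, rfl, rfl, rfl⟩ <;>
    rcases h' with h' | h' | h' | h' | h' | h' | h' <;> omega

/-- The neighbours of the two vertices of high degree. -/
theorem threeHubRel_hub_iff {j x a b : ℕ}
    (h : (x = 4 * j + 6 ∧ a = 2 ∧ b = 4 * j + 7) ∨ (x = 4 * j + 7 ∧ a = 2 * j + 2 ∧ b = 4 * j + 6))
    (y : ℕ) : (y = 0 ∨ y = 4 * j + 2 ∨ y = 4 * j + 3 ∨ y = 4 * j + 4 ∨ y = b ∨
        a ≤ y ∧ y < a + 2 * j) ↔
      y < 4 * j + 8 ∧ x ≠ y ∧ (threeHubRel j x y ∨ threeHubRel j y x) := by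
  constructor
  · intro hy
    refine ⟨by omega, by omega, ?_⟩
    unfold threeHubRel
    rcases h with ⟨rfl, rfl, rfl⟩ | ⟨rfl, rfl, rfl⟩
    · rcases hy with rfl | rfl | rfl | rfl | rfl | hy
      · simp
      · simp
      · simp
      · simp
      · simp
      · exact .inr (.inr (.inr (.inr (.inl ⟨hy.1, by omega, rfl⟩))))
    · rcases hy with rfl | rfl | rfl | rfl | rfl | hy
      · simp
      · simp
      · simp
      · simp
      · simp
      · exact .inr (.inr (.inr (.inr (.inr (.inl ⟨hy.1, by omega, rfl⟩)))))
  · rintro ⟨hy, hxy, h' | h'⟩ <;> rcases h with ⟨rfl, rfl, rfl⟩ | ⟨rfl, rfl, rfl⟩ <;>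
    rcases h' with h' | h' | h' | h' | h' | h' | h' <;> omega

/-- Two vertices `c`, `d` with neighbours `w`, `u`, `v`, and two vertices `p`, `q` with neighbours
`u`, `v` and one more each: the use of `u` and `v` leaves two choices. -/
theorem IsSpanningCycleRel.three_hubs {n : ℕ} {R e : ℕ → ℕ → Prop} (h : IsSpanningCycleRel n R e)
    {c d w u v p q p' q' : ℕ} (hc : c < n) (hd : d < n) (hp : p < n) (hq : q < n)
    (hne : [c, d, w, u, v, p, q].Nodup) (hp' : p' ≠ u ∧ p' ≠ v) (hq' : q' ≠ u ∧ q' ≠ v)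
    (hRc : ∀ y < n, c ≠ y → R c y ∨ R y c → y = w ∨ y = u ∨ y = v)
    (hRd : ∀ y < n, d ≠ y → R d y ∨ R y d → y = w ∨ y = u ∨ y = v)
    (hRp : ∀ y < n, p ≠ y → R p y ∨ R y p → y = p' ∨ y = u ∨ y = v)
    (hRq : ∀ y < n, q ≠ y → R q y ∨ R y q → y = q' ∨ y = u ∨ y = v) :
    (e c w ∧ e d w ∧ e p p' ∧ e q q') ∧
      ((e c v ↔ ¬ e c u) ∧ (e d u ↔ ¬ e c u) ∧ (e d v ↔ e c u)) ∧
      ((e p v ↔ ¬ e p u) ∧ (e q u ↔ ¬ e p u) ∧ (e q v ↔ e p u)) := by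
  simp only [List.nodup_cons, List.mem_cons, List.not_mem_nil, or_false, not_or] at hne
  obtain ⟨⟨hcd, hcw, hcu, hcv, hcp, hcq⟩, ⟨hdw, hdu, hdv, hdp, hdq⟩, ⟨hwu, hwv, hwp, hwq⟩,
    ⟨huv, hup, huq⟩, ⟨hvp, hvq⟩, hpq, -⟩ := hne
  have tc := h.two_of_three hc hwu hwv huv hRc
  have td := h.two_of_three hd hwu hwv huv hRd
  have tp := h.two_of_three hp hp'.1 hp'.2 huv hRp
  have tq := h.two_of_three hq hq'.1 hq'.2 huv hRq
  have hn : ∀ x {a b c}, a ≠ b → a ≠ c → b ≠ c → e a x → e b x → e c x → False :=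
    fun x a b c hab hac hbc ha hb hc =>
      h.not_three hab hac hbc (h.symm _ _ ha) (h.symm _ _ hb) (h.symm _ _ hc)
  have hsq : ∀ x y, x ≠ y → p ≠ x → p ≠ y → e c x → e d x → e d y → e c y → False :=
    fun x y hxy hpx hpy h1 h2 h3 h4 =>
      h.no_square h1 (h.symm _ _ h2) h3 (h.symm _ _ h4) hcd hxy hp (Ne.symm hcp) hpx (Ne.symm hdp) hpy
  have s1 := hsq w u hwu (Ne.symm hwp) (Ne.symm hup)
  have s2 := hsq w v hwv (Ne.symm hwp) (Ne.symm hvp)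
  have s3 := hsq u v huv (Ne.symm hup) (Ne.symm hvp)
  have u1 := hn u hcd hcp hdp
  have u2 := hn u hcd hcq hdq
  have u3 := hn u hcp hcq hpq
  have u4 := hn u hdp hdq hpq
  have v1 := hn v hcd hcp hdp
  have v2 := hn v hcd hcq hdq
  have v3 := hn v hcp hcq hpq
  have v4 := hn v hdp hdq hpq
  clear hRc hRd hRp hRq h hn hsq hc hd hp hq hp' hq' hcd hcp hcq hdp hdq hpq hcw hcu hcv hdw hdu
    hdv hwu hwv hwp hwq huv hup huq hvp hvq
  -- The vertices `u` and `v` have room for four cycle edges, and each of `c`, `d`, `p`, `q` needs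
  -- at least one. Hence each uses exactly one, together with its remaining edge.
  have hw : e c w ∧ e d w := by grind
  -- If `c` and `d` used the same one of `u`, `v`, a square through `w` would close. So they use
  -- different ones, and `p` and `q` share what is left.
  have hcu : (e c v ↔ ¬ e c u) ∧ (e d u ↔ ¬ e c u) ∧ (e d v ↔ e c u) := by
    clear u1 u2 u3 u4 v1 v2 v3 v4 tp tq
    grind
  refine ⟨?_, hcu, ?_⟩ <;> by_cases hc : e c u <;> clear tc td s1 s2 s3 <;> grind

theorem injOn_threeHub (j : ℕ) :
    Set.InjOn (fun E => (edgeRel E 0 (4 * j + 6), edgeRel E (4 * j + 3) (4 * j + 6)))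
      (hamiltonianCycles (natGraph (4 * j + 8) (threeHubRel j))) := by
  refine injOn_edgeRel (fun α β x y =>
    (y = x + 1 ∧ y ≤ 4 * j + 2) ∨ (x = 0 ∧ y = 4 * j + 6 ∧ α) ∨ (x = 0 ∧ y = 4 * j + 7 ∧ ¬ α) ∨
    (x = 4 * j + 2 ∧ y = 4 * j + 6 ∧ ¬ α) ∨ (x = 4 * j + 2 ∧ y = 4 * j + 7 ∧ α) ∨
    (x = 4 * j + 3 ∧ y = 4 * j + 5) ∨ (x = 4 * j + 4 ∧ y = 4 * j + 5) ∨
    (x = 4 * j + 3 ∧ y = 4 * j + 6 ∧ β) ∨ (x = 4 * j + 3 ∧ y = 4 * j + 7 ∧ ¬ β) ∨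
    (x = 4 * j + 4 ∧ y = 4 * j + 6 ∧ ¬ β) ∨ (x = 4 * j + 4 ∧ y = 4 * j + 7 ∧ β)) _ _ _ _ ?_
  intro e h x y hx hy hxy
  have hnbr : ∀ {x p q r : ℕ} (_ : _) (y : ℕ) (_ : y < 4 * j + 8) (_ : x ≠ y)
      (_ : threeHubRel j x y ∨ threeHubRel j y x), y = p ∨ y = q ∨ y = r :=
    fun h y h1 h2 h3 => (threeHubRel_iff h y).2 ⟨h1, h2, h3⟩
  obtain ⟨⟨hcw, hdw, h01, hq⟩, ⟨c1, c2, c3⟩, p1, p2, p3⟩ := h.three_hubs (c := 4 * j + 3)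
    (d := 4 * j + 4) (w := 4 * j + 5) (u := 4 * j + 6) (v := 4 * j + 7) (p := 0) (q := 4 * j + 2)
    (p' := 1) (q' := 4 * j + 1) (by omega) (by omega) (by omega) (by omega)
    (by simp) (by omega) (by omega)
    (hnbr (.inr (.inr (.inr (.inr (.inr (.inl ⟨.inl rfl, rfl, rfl, rfl⟩)))))))
    (hnbr (.inr (.inr (.inr (.inr (.inr (.inl ⟨.inr rfl, rfl, rfl, rfl⟩)))))))
    (hnbr (.inl ⟨rfl, rfl, rfl, rfl⟩))
    (hnbr (.inr (.inr (.inr (.inr (.inl ⟨rfl, rfl, rfl, rfl⟩))))))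
  have hsat : ∀ z, z = 4 * j + 6 ∨ z = 4 * j + 7 → (∃ a b, a ≠ b ∧
      (a = 0 ∨ a = 4 * j + 2) ∧ (b = 4 * j + 3 ∨ b = 4 * j + 4) ∧ e a z ∧ e b z) := by
    rintro z (rfl | rfl)
    · obtain ⟨a, ha, ha'⟩ : ∃ a, (a = 0 ∨ a = 4 * j + 2) ∧ e a (4 * j + 6) := by
        by_cases h0 : e 0 (4 * j + 6)
        · exact ⟨0, .inl rfl, h0⟩
        · exact ⟨_, .inr rfl, p2.2 h0⟩
      obtain ⟨b, hb, hb'⟩ : ∃ b, (b = 4 * j + 3 ∨ b = 4 * j + 4) ∧ e b (4 * j + 6) := by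
        by_cases h0 : e (4 * j + 3) (4 * j + 6)
        · exact ⟨_, .inl rfl, h0⟩
        · exact ⟨_, .inr rfl, c2.2 h0⟩
      exact ⟨a, b, by omega, ha, hb, ha', hb'⟩
    · obtain ⟨a, ha, ha'⟩ : ∃ a, (a = 0 ∨ a = 4 * j + 2) ∧ e a (4 * j + 7) := by
        by_cases h0 : e 0 (4 * j + 6)
        · exact ⟨_, .inr rfl, p3.2 h0⟩
        · exact ⟨_, .inl rfl, p1.2 h0⟩
      obtain ⟨b, hb, hb'⟩ : ∃ b, (b = 4 * j + 3 ∨ b = 4 * j + 4) ∧ e b (4 * j + 7) := by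
        by_cases h0 : e (4 * j + 3) (4 * j + 6)
        · exact ⟨_, .inr rfl, c3.2 h0⟩
        · exact ⟨_, .inl rfl, c1.2 h0⟩
      exact ⟨a, b, by omega, ha, hb, ha', hb'⟩
  -- Both large hubs are saturated by a path end and one of `4 * j + 3`, `4 * j + 4`; this also
  -- excludes the edge joining the hubs. Every inner path vertex thus loses its edge off the path,
  -- once `4 * j + 5` is seen to be saturated as well.
  have hunused : ∀ i z, z = 4 * j + 6 ∨ z = 4 * j + 7 → i ≠ 0 → i ≠ 4 * j + 2 → i ≠ 4 * j + 3 →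
      i ≠ 4 * j + 4 → ¬ e i z := by
    intro i z hz h1 h2 h3 h4 hiz
    obtain ⟨a, b, hab, ha, hb, ha', hb'⟩ := hsat z hz
    exact h.not_three hab (by omega) (by omega) (h.symm _ _ ha') (h.symm _ _ hb') (h.symm _ _ hiz)
  have h1w : ¬ e 1 (4 * j + 5) := fun h1 =>
    h.not_three (by omega) (by omega) (by omega) (h.symm _ _ hcw) (h.symm _ _ hdw) (h.symm _ _ h1)
  have hpath : ∀ i, i < 4 * j + 2 → e i (i + 1) := by
    intro i hi
    rcases (by omega : i = 0 ∨ i = 1 ∨ (2 ≤ i ∧ i ≤ 2 * j + 1) ∨ 2 * j + 2 ≤ i) with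
      rfl | rfl | hi' | hi'
    · exact h01
    · exact (h.and_of_not (p := 0) h1w (by omega) (by omega) (by omega) (by omega)
        (hnbr (.inr (.inl ⟨rfl, rfl, rfl, rfl⟩)))).2
    · have hi := hunused i (4 * j + 6) (by omega) (by omega) (by omega) (by omega) (by omega)
      exact (h.and_of_not (p := i - 1) hi (by omega) (by omega) (by omega) (by omega)
        (hnbr (.inr (.inr (.inl ⟨hi'.1, hi'.2, rfl, rfl, rfl⟩))))).2
    · have hi := hunused i (4 * j + 7) (by omega) (by omega) (by omega) (by omega) (by omega)
      exact (h.and_of_not (p := i - 1) hi (by omega) (by omega) (by omega) (by omega)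
        (hnbr (.inr (.inr (.inr (.inl ⟨hi', by omega, rfl, rfl, rfl⟩)))))).2
  clear hsat
  have hcases : (y = x + 1 ∧ y ≤ 4 * j + 2) ∨ (x = 1 ∧ y = 4 * j + 5) ∨
      (((y = 4 * j + 6 ∨ y = 4 * j + 7) ∧ x ≠ 0 ∧ x ≠ 4 * j + 2 ∧ x ≠ 4 * j + 3 ∧ x ≠ 4 * j + 4)) ∨
      ((x = 0 ∨ x = 4 * j + 2) ∧ (y = 4 * j + 6 ∨ y = 4 * j + 7)) ∨
      ((x = 4 * j + 3 ∨ x = 4 * j + 4) ∧ (y = 4 * j + 5 ∨ y = 4 * j + 6 ∨ y = 4 * j + 7)) := by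
    clear * - hxy
    unfold threeHubRel at hxy
    grind
  rcases hcases with ⟨rfl, hx⟩ | ⟨rfl, rfl⟩ | ⟨hz, h1, h2, h3, h4⟩ |
    ⟨rfl | rfl, rfl | rfl⟩ | ⟨rfl | rfl, rfl | rfl | rfl⟩
  · exact iff_of_true (hpath x (by omega)) (.inl ⟨rfl, hx⟩)
  · simp [h1w]
  · have h5 : ¬ (y = x + 1 ∧ y ≤ 4 * j + 2) := by omega
    simp [hunused x y hz h1 h2 h3 h4, h1, h2, h3, h4, h5]
  · simp
  · simp [p1]
  · simp [p2]
  · simp [p3]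
  · simp [hcw]
  · simp
  · simp [c1]
  · simp [hdw]
  · simp [c2]
  · simp [c3]

theorem isHamiltonian_threeHub (j : ℕ) :
    (natGraph (4 * j + 8) (threeHubRel j)).IsHamiltonian := by
  -- One large hub, the whole path, the other large hub, then `4 * j + 4`, `4 * j + 5`, `4 * j + 3`.
  obtain ⟨f, hf⟩ : ∃ f : ℕ → ℕ, ∀ i, (i = 0 ∧ f i = 4 * j + 6) ∨
      (1 ≤ i ∧ i ≤ 4 * j + 3 ∧ f i = i - 1) ∨ (i = 4 * j + 4 ∧ f i = 4 * j + 7) ∨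
      (i = 4 * j + 5 ∧ f i = 4 * j + 4) ∨ (i = 4 * j + 6 ∧ f i = 4 * j + 5) ∨
      (4 * j + 7 ≤ i ∧ f i = 4 * j + 3) := by
    refine ⟨fun i => if i = 0 then 4 * j + 6 else if i ≤ 4 * j + 3 then i - 1 else
      if i = 4 * j + 4 then 4 * j + 7 else if i = 4 * j + 5 then 4 * j + 4 else
      if i = 4 * j + 6 then 4 * j + 5 else 4 * j + 3, fun i => ?_⟩
    dsimp only
    split_ifs <;> omega
  have f0 : f 0 = 4 * j + 6 := by have := hf 0; omega
  have fm : f (4 * j + 7) = 4 * j + 3 := by have := hf (4 * j + 7); omega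
  obtain ⟨E, hE, -⟩ := exists_mem_hamiltonianCycles_natGraph (n := 4 * j + 8)
    (R := threeHubRel j) (m := 4 * j + 7) (by omega) rfl f
    (fun i hi => by have := hf i; omega)
    (fun i j hi hj hij => by have := hf i; have := hf j; omega)
    (fun i hi => by
      have h1 := hf i; have h2 := hf (i + 1)
      clear hf f0 fm
      unfold threeHubRel
      generalize f i = a at *
      generalize f (i + 1) = b at *
      rcases (by omega : (a = 4 * j + 6 ∧ b = 0) ∨ (b = a + 1 ∧ b ≤ 4 * j + 2) ∨
        (a = 4 * j + 2 ∧ b = 4 * j + 7) ∨ (a = 4 * j + 7 ∧ b = 4 * j + 4) ∨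
        (a = 4 * j + 4 ∧ b = 4 * j + 5) ∨ (a = 4 * j + 5 ∧ b = 4 * j + 3)) with
        ⟨rfl, rfl⟩ | h | ⟨rfl, rfl⟩ | ⟨rfl, rfl⟩ | ⟨rfl, rfl⟩ | ⟨rfl, rfl⟩
      · simp
      · exact .inl (.inl h)
      · simp
      · simp
      · simp
      · simp)
    (by rw [f0, fm]; simp [threeHubRel])
  exact isHamiltonian_of_mem hE

theorem isBiregular_threeHub (j : ℕ) :
    IsBiregular (natGraph (4 * j + 8) (threeHubRel j)) 3 (2 * j + 5) := by
  classical
  have hhub : ∀ i : Fin (4 * j + 8), (i : ℕ) = 4 * j + 6 ∨ (i : ℕ) = 4 * j + 7 →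
      (natGraph (4 * j + 8) (threeHubRel j)).degree i = 2 * j + 5 := by
    intro i hi
    obtain ⟨a, b, ha, hb, h⟩ : ∃ a b, (2 ≤ a ∧ a + 2 * j ≤ 4 * j + 2) ∧
        (b = 4 * j + 6 ∨ b = 4 * j + 7) ∧ ∀ y, (y = 0 ∨ y = 4 * j + 2 ∨ y = 4 * j + 3 ∨
          y = 4 * j + 4 ∨ y = b ∨ a ≤ y ∧ y < a + 2 * j) ↔
        y < 4 * j + 8 ∧ (i : ℕ) ≠ y ∧ (threeHubRel j i y ∨ threeHubRel j y i) := by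
      rcases hi with hi | hi
      · exact ⟨2, 4 * j + 7, by omega, by omega, threeHubRel_hub_iff (.inl ⟨hi, rfl, rfl⟩)⟩
      · exact ⟨2 * j + 2, 4 * j + 6, by omega, by omega, threeHubRel_hub_iff (.inr ⟨hi, rfl, rfl⟩)⟩
    rw [degree_natGraph i ({0, 4 * j + 2, 4 * j + 3, 4 * j + 4, b} ∪ Finset.Ico a (a + 2 * j))
      (fun y => by rw [← h y]; simp only [Finset.mem_union, Finset.mem_insert,
        Finset.mem_singleton, Finset.mem_Ico, or_assoc])]
    rw [Finset.card_union_of_disjoint, Nat.card_Ico]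
    · rw [Finset.card_insert_of_notMem, Finset.card_insert_of_notMem, Finset.card_insert_of_notMem,
        Finset.card_pair]
      · omega
      all_goals simp
      all_goals omega
    · rw [Finset.disjoint_left]
      simp only [Finset.mem_insert, Finset.mem_singleton, Finset.mem_Ico]
      omega
  have hlow : ∀ i : Fin (4 * j + 8), (i : ℕ) < 4 * j + 6 →
      (natGraph (4 * j + 8) (threeHubRel j)).degree i = 3 := by
    intro i hi
    obtain ⟨p, q, r, h1, h2, h3, h⟩ : ∃ p q r, p ≠ q ∧ p ≠ r ∧ q ≠ r ∧
        ∀ y, (y = p ∨ y = q ∨ y = r) ↔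
          y < 4 * j + 8 ∧ (i : ℕ) ≠ y ∧ (threeHubRel j i y ∨ threeHubRel j y i) := by
      generalize (i : ℕ) = x at hi
      rcases (by omega : x = 0 ∨ x = 1 ∨ (2 ≤ x ∧ x ≤ 2 * j + 1) ∨ (2 * j + 2 ≤ x ∧ x ≤ 4 * j + 1) ∨
        x = 4 * j + 2 ∨ (x = 4 * j + 3 ∨ x = 4 * j + 4) ∨ x = 4 * j + 5) with h | h | h | h | h | h | h
      · exact ⟨1, 4 * j + 6, 4 * j + 7, by omega, by omega, by omega,
          threeHubRel_iff (.inl ⟨h, rfl, rfl, rfl⟩)⟩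
      · exact ⟨0, 2, 4 * j + 5, by omega, by omega, by omega,
          threeHubRel_iff (.inr (.inl ⟨h, rfl, rfl, rfl⟩))⟩
      · exact ⟨x - 1, x + 1, 4 * j + 6, by omega, by omega, by omega,
          threeHubRel_iff (.inr (.inr (.inl ⟨h.1, h.2, rfl, rfl, rfl⟩)))⟩
      · exact ⟨x - 1, x + 1, 4 * j + 7, by omega, by omega, by omega,
          threeHubRel_iff (.inr (.inr (.inr (.inl ⟨h.1, h.2, rfl, rfl, rfl⟩))))⟩
      · exact ⟨4 * j + 1, 4 * j + 6, 4 * j + 7, by omega, by omega, by omega,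
          threeHubRel_iff (.inr (.inr (.inr (.inr (.inl ⟨h, rfl, rfl, rfl⟩)))))⟩
      · exact ⟨4 * j + 5, 4 * j + 6, 4 * j + 7, by omega, by omega, by omega,
          threeHubRel_iff (.inr (.inr (.inr (.inr (.inr (.inl ⟨h, rfl, rfl, rfl⟩))))))⟩
      · exact ⟨1, 4 * j + 3, 4 * j + 4, by omega, by omega, by omega,
          threeHubRel_iff (.inr (.inr (.inr (.inr (.inr (.inr (⟨h, rfl, rfl, rfl⟩)))))))⟩
    rw [degree_natGraph _ {p, q, r} (fun j => by simpa using h j)]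
    exact Finset.card_eq_three.2 ⟨p, q, r, h1, h2, h3, rfl⟩
  refine ⟨fun i => ?_, ⟨⟨0, by omega⟩, ?_⟩, ⟨⟨4 * j + 6, by omega⟩, ?_⟩⟩
  · by_cases hi : (i : ℕ) < 4 * j + 6
    · left
      convert hlow i hi
    · right
      convert hhub i (by omega)
  · convert hlow ⟨0, by omega⟩ (by simp)
  · convert hhub ⟨4 * j + 6, by omega⟩ (.inl rfl)

theorem vertexConnectivity_threeHub (j : ℕ) :
    vertexConnectivity (natGraph (4 * j + 8) (threeHubRel j)) = 3 := by
  refine vertexConnectivity_natGraph (by omega) {4 * j + 5, 4 * j + 6, 4 * j + 7} ?_ ?_ ?_ ?_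
  · exact Finset.card_eq_three.2 ⟨_, _, _, by omega, by omega, by omega, rfl⟩
  · simp
  · refine ⟨fun x => x = 4 * j + 3, fun x y hx hy => ?_, 4 * j + 3, 4 * j + 4, ?_⟩
    · simp only [Finset.mem_insert, Finset.mem_singleton]
      unfold threeHubRel
      omega
    · simp
  · intro T hT X hX
    have hthree : ∀ x y z, x ≠ y → x ≠ z → y ≠ z → x ∈ T → y ∈ T → z ∉ T := by
      intro x y z hxy hxz hyz hx hy hz
      have := Finset.card_le_card (s := {x, y, z}) (t := T) (by
        intro w hw
        simp only [Finset.mem_insert, Finset.mem_singleton] at hw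
        rcases hw with rfl | rfl | rfl <;> assumption)
      rw [Finset.card_eq_three.2 ⟨x, y, z, hxy, hxz, hyz, rfl⟩] at this
      omega
    have hX' : ∀ x y, x < y → y < 4 * j + 8 → x ∉ T → y ∉ T → threeHubRel j x y → (X x ↔ X y) :=
      fun x y h1 h2 => hX x y (by omega) h2 (by omega)
    suffices h : ∃ p : Prop, ∀ x, x < 4 * j + 8 → x ∉ T → (X x ↔ p) by
      obtain ⟨p, h⟩ := h
      exact fun x y hx hy hxT hyT => (h x hx hxT).trans (h y hy hyT).symm
    have hend : ∀ x h, (h = 4 * j + 6 ∨ h = 4 * j + 7) →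
        (x = 0 ∨ x = 4 * j + 2 ∨ x = 4 * j + 3 ∨ x = 4 * j + 4) → x ∉ T → h ∉ T → (X x ↔ X h) := by
      intro x h hh hx hxT hhT
      refine hX' x h (by omega) (by omega) hxT hhT ?_
      rcases hh with rfl | rfl <;> rcases hx with rfl | rfl | rfl | rfl <;> simp [threeHubRel]
    have hw : ∀ x, (x = 1 ∨ x = 4 * j + 3 ∨ x = 4 * j + 4) → x ∉ T → 4 * j + 5 ∉ T →
        (X x ↔ X (4 * j + 5)) := by
      intro x hx hxT hwT
      refine hX' x _ (by omega) (by omega) hxT hwT ?_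
      rcases hx with rfl | rfl | rfl <;> simp [threeHubRel]
    have hstep : ∀ i, i < 4 * j + 2 → i ∉ T → i + 1 ∉ T → (X i ↔ X (i + 1)) := fun i hi h1 h2 =>
      hX' i (i + 1) (by omega) (by omega) h1 h2 (.inl ⟨rfl, by omega⟩)
    have hrun : ∀ a b, a ≤ b → b ≤ 4 * j + 2 → (∀ i, a ≤ i → i ≤ b → i ∉ T) → (X a ↔ X b) :=
      fun a b hab hb h => iff_of_forall_succ hab fun i h1 h2 =>
        hstep i (by omega) (h i h1 (by omega)) (h (i + 1) (by omega) (by omega))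
    -- If just one large hub is deleted, at most one further vertex is. A path vertex then reaches
    -- an end of the path on its intact side, and `4 * j + 5` reaches `4 * j + 3` or `4 * j + 4`;
    -- all of these are adjacent to the surviving hub.
    have hone : ∀ h h', (h = 4 * j + 6 ∧ h' = 4 * j + 7 ∨ h = 4 * j + 7 ∧ h' = 4 * j + 6) →
        h ∉ T → h' ∈ T → ∀ x, x < 4 * j + 8 → x ∉ T → (X x ↔ X h) := by
      intro h h' hh hT hT' x hx hxT
      have hother : ∀ y z, y ≠ h' → z ≠ h' → y ≠ z → y ∈ T → z ∉ T := fun y z h1 h2 h3 =>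
        hthree h' y z h1.symm h2.symm h3 hT'
      rcases (by omega : x ≤ 4 * j + 2 ∨ (x = 4 * j + 3 ∨ x = 4 * j + 4) ∨ x = 4 * j + 5 ∨
        x = h ∨ x = h') with hx | hx | rfl | rfl | rfl
      · by_cases hl : ∃ i, i < x ∧ i ∈ T
        · obtain ⟨i, hi, hiT⟩ := hl
          have hr : ∀ y, x ≤ y → y ≤ 4 * j + 2 → y ∉ T := fun y h1 h2 =>
            hother i y (by omega) (by omega) (by omega) hiT
          exact (hrun x (4 * j + 2) hx le_rfl hr).trans
            (hend _ h (by omega) (by omega) (hr _ hx le_rfl) hT)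
        · have hr : ∀ y, 0 ≤ y → y ≤ x → y ∉ T := fun y _ h2 hy => by
            obtain rfl | h3 := h2.eq_or_lt
            · exact hxT hy
            · exact hl ⟨y, h3, hy⟩
          exact (hrun 0 x (Nat.zero_le _) hx hr).symm.trans
            (hend _ h (by omega) (by omega) (hr _ le_rfl (Nat.zero_le _)) hT)
      · exact hend x h (by omega) (by omega) hxT hT
      · by_cases hc : 4 * j + 3 ∈ T
        · have hd := hother _ (4 * j + 4) (by omega) (by omega) (by omega) hc
          exact (hw _ (by omega) hd hxT).symm.trans (hend _ h (by omega) (by omega) hd hT)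
        · exact (hw _ (by omega) hc hxT).symm.trans (hend _ h (by omega) (by omega) hc hT)
      · rfl
      · exact (hxT hT').elim
    by_cases hu : 4 * j + 6 ∈ T <;> by_cases hv : 4 * j + 7 ∈ T
    · have hr : ∀ x, x < 4 * j + 6 → x ∉ T := fun x hx =>
        hthree _ _ x (by omega) (by omega) (by omega) hu hv
      have hwT := hr (4 * j + 5) (by omega)
      refine ⟨X (4 * j + 5), fun x hx hxT => ?_⟩
      rcases (by omega : x ≤ 4 * j + 2 ∨ (x = 4 * j + 3 ∨ x = 4 * j + 4) ∨ x = 4 * j + 5 ∨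
        x = 4 * j + 6 ∨ x = 4 * j + 7) with hx | hx | rfl | rfl | rfl
      · exact ((hrun 0 x (Nat.zero_le _) hx fun i _ _ => hr i (by omega)).symm.trans
          (hrun 0 1 (by omega) (by omega) fun i _ _ => hr i (by omega))).trans
          (hw 1 (.inl rfl) (hr 1 (by omega)) hwT)
      · exact hw x (.inr hx) hxT hwT
      · rfl
      · exact (hxT hu).elim
      · exact (hxT hv).elim
    · exact ⟨_, hone _ _ (.inr ⟨rfl, rfl⟩) hv hu⟩
    · exact ⟨_, hone _ _ (.inl ⟨rfl, rfl⟩) hu hv⟩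
    -- Both large hubs survive, and only `1` and `4 * j + 5` are adjacent to neither. Each of these
    -- two has three neighbours, so one remains and leads on to a hub.
    · refine ⟨X (4 * j + 6), fun x hx hxT => ?_⟩
      have huv : X (4 * j + 6) ↔ X (4 * j + 7) :=
        hX' _ _ (by omega) (by omega) hu hv (by simp [threeHubRel])
      have hp : ∀ x, x ≤ 4 * j + 2 → x ≠ 1 → x ∉ T → (X x ↔ X (4 * j + 6)) := by
        intro x hx h1 hxT
        by_cases h2 : x ≤ 2 * j + 1 ∨ x = 4 * j + 2
        · exact hX' _ _ (by omega) (by omega) hxT hu (by unfold threeHubRel; omega)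
        · exact (hX' _ _ (by omega) (by omega) hxT hv (by unfold threeHubRel; omega)).trans huv.symm
      have hcd : ∀ x, x = 4 * j + 3 ∨ x = 4 * j + 4 → x ∉ T → (X x ↔ X (4 * j + 6)) :=
        fun x hx hxT => hend x _ (by omega) (by omega) hxT hu
      rcases (by omega : x = 1 ∨ (x ≤ 4 * j + 2 ∧ x ≠ 1) ∨ (x = 4 * j + 3 ∨ x = 4 * j + 4) ∨
        x = 4 * j + 5 ∨ x = 4 * j + 6 ∨ x = 4 * j + 7) with rfl | hx | hx | rfl | rfl | rfl
      · by_cases h0 : 0 ∈ T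
        · by_cases h2 : 2 ∈ T
          · have hr := fun x h1 h3 => hthree 0 2 x (by omega) h1 h3 h0 h2
            have hwT := hr (4 * j + 5) (by omega) (by omega)
            have hcT := hr (4 * j + 3) (by omega) (by omega)
            exact (hw 1 (.inl rfl) hxT hwT).trans ((hw _ (by omega) hcT hwT).symm.trans
              (hcd _ (.inl rfl) hcT))
          · exact (hstep 1 (by omega) hxT h2).trans (hp 2 (by omega) (by omega) h2)
        · exact (hstep 0 (by omega) h0 hxT).symm.trans (hp 0 (by omega) (by omega) h0)
      · exact hp x hx.1 hx.2 hxT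
      · exact hcd x hx hxT
      · by_cases hc : 4 * j + 3 ∈ T
        · by_cases hd : 4 * j + 4 ∈ T
          · have hr := fun x h1 h3 => hthree _ _ x (by omega) h1 h3 hc hd
            have h0 := hr 0 (by omega) (by omega)
            have h1 := hr 1 (by omega) (by omega)
            exact (hw 1 (.inl rfl) h1 hxT).symm.trans ((hstep 0 (by omega) h0 h1).symm.trans
              (hp 0 (by omega) (by omega) h0))
          · exact (hw _ (by omega) hd hxT).symm.trans (hcd _ (.inr rfl) hd)
        · exact (hw _ (by omega) hc hxT).symm.trans (hcd _ (.inl rfl) hc)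
      · rfl
      · exact huv.symm

/-! ### Lower bounds on the order -/

theorem two_mul_add_two_le {k n : ℕ} {G : SimpleGraph (Fin n)}
    (hG : IsBiregular G 3 (2 * k + 1)) : 2 * k + 2 ≤ n := by
  classical
  obtain ⟨-, -, v, hv⟩ := hG
  have := G.degree_lt_card_verts v
  rw [Fintype.card_fin] at this
  have h : G.degree v = 2 * k + 1 := by convert hv
  omega

theorem even_card_of_odd_degree {V : Type*} [Fintype V] {G : SimpleGraph V} [DecidableRel G.Adj]
    (h : ∀ v, Odd (G.degree v)) : Even (Fintype.card V) := by
  have := G.even_card_odd_degree_vertices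
  rwa [Finset.filter_true_of_mem fun v _ => h v, Finset.card_univ] at this

/-- If two vertices are adjacent to all others and there are at least eight vertices, then a
Hamiltonian cycle forces four vertices adjacent to all others, so that no vertex has degree
three. -/
theorem not_two_dominating {V : Type*} [Fintype V] [DecidableEq V] {G : SimpleGraph V}
    [DecidableRel G.Adj] {d : ℕ} (hV : 8 ≤ Fintype.card V) {E : Set (Sym2 V)}
    (hE : IsSpanningCycle G E) (hdeg : ∀ v, G.degree v = 3 ∨ G.degree v = d)
    (hd : ∀ v, G.degree v = d → ∀ x, x ≠ v → G.Adj v x) {v w : V} (hvw : v ≠ w)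
    (hv : G.degree v = d) (hw : G.degree w = d) {t : V} (ht : G.degree t = 3) (ht' : 3 ≠ d) :
    False := by
  obtain ⟨a, b, -, hab⟩ := hE.two v
  obtain ⟨a', b', -, hab'⟩ := hE.two w
  -- A degree-three vertex outside this set would have four neighbours: `v`, `w` and its own two
  -- cycle neighbours, which differ from `v` and `w`.
  have hhigh : ∀ x, x ∉ ({v, w, a, b, a', b'} : Finset V) → G.degree x = d := by
    intro x hx
    simp only [Finset.mem_insert, Finset.mem_singleton, not_or] at hx
    refine (hdeg x).resolve_left fun h3 => ?_
    obtain ⟨y, z, hyz, h2⟩ := hE.two x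
    have hy := (h2 y).2 (.inl rfl)
    have hz := (h2 z).2 (.inr rfl)
    have hne : ∀ y, s(x, y) ∈ E → y ≠ v ∧ y ≠ w := by
      refine fun y hy => ⟨?_, ?_⟩ <;> rintro rfl <;> rw [Sym2.eq_swap] at hy
      · have := (hab x).1 hy; tauto
      · have := (hab' x).1 hy; tauto
    have hsub : ({v, w, y, z} : Finset V) ⊆ G.neighborFinset x := by
      intro c hc
      simp only [Finset.mem_insert, Finset.mem_singleton] at hc
      rw [SimpleGraph.mem_neighborFinset]
      rcases hc with rfl | rfl | rfl | rfl
      · exact (hd _ hv x hx.1).symm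
      · exact (hd _ hw x hx.2.1).symm
      · exact hE.adj _ _ hy
      · exact hE.adj _ _ hz
    have hc := Finset.card_le_card hsub
    rw [SimpleGraph.card_neighborFinset_eq_degree, h3] at hc
    have h1 := hne y hy
    have h2 := hne z hz
    rw [Finset.card_insert_of_notMem, Finset.card_insert_of_notMem, Finset.card_pair hyz] at hc
    · omega
    · simp [h1.2.symm, h2.2.symm]
    · simp [hvw, h1.1.symm, h2.1.symm]
  have hc : 2 ≤ (Finset.univ \ ({v, w, a, b, a', b'} : Finset V)).card := by
    rw [Finset.card_sdiff_of_subset (Finset.subset_univ _), Finset.card_univ]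
    have := Finset.card_le_six (a := v) (b := w) (c := a) (d := b) (e := a') (f := b')
    omega
  obtain ⟨x, hx, y, hy, hxy⟩ := Finset.one_lt_card.1 hc
  rw [Finset.mem_sdiff] at hx hy
  have hxd := hhigh x hx.2
  have hyd := hhigh y hy.2
  have hsub : ({v, w, x, y} : Finset V) ⊆ G.neighborFinset t := by
    intro c hc
    simp only [Finset.mem_insert, Finset.mem_singleton] at hc
    rw [SimpleGraph.mem_neighborFinset]
    have : G.degree c = d := by rcases hc with rfl | rfl | rfl | rfl <;> assumption
    exact (hd c this t (by rintro rfl; exact ht' (ht.symm.trans this))).symm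
  have hc := Finset.card_le_card hsub
  have h1 := hx.2
  have h2 := hy.2
  simp only [Finset.mem_insert, Finset.mem_singleton, not_or] at h1 h2
  rw [SimpleGraph.card_neighborFinset_eq_degree, ht, Finset.card_insert_of_notMem,
    Finset.card_insert_of_notMem, Finset.card_pair hxy] at hc
  · omega
  · simp [Ne.symm h1.2.1, Ne.symm h2.2.1]
  · simp [hvw, Ne.symm h1.1, Ne.symm h2.1]

/-- A Hamiltonian cycle through a vertex `v` as a cyclic enumeration `f` starting from `v`. -/
theorem exists_enumeration {V : Type*} [Fintype V] [DecidableEq V] {G : SimpleGraph V}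
    {E : Set (Sym2 V)} (h : E ∈ hamiltonianCycles G) (v : V) :
    ∃ f : ℕ → V, f 0 = v ∧ f (Fintype.card V) = v ∧
      (∀ i < Fintype.card V, G.Adj (f i) (f (i + 1))) ∧
      ∀ i j, i < Fintype.card V → j < Fintype.card V → f i = f j → i = j := by
  obtain ⟨a, p, hp, -⟩ := h
  have hq := hp.rotate (hp.mem_support v)
  set q := p.rotate v (hp.mem_support v)
  rw [← hq.length_eq]
  refine ⟨q.getVert, q.getVert_zero, q.getVert_length, fun i hi => q.adj_getVert_succ hi,
    fun i j hi hj hij => hq.isCycle.getVert_injOn' ?_ ?_ hij⟩ <;>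
  simp only [Set.mem_ofPred_eq] <;> omega

/-- A wheel with at least six spokes has at least five Hamiltonian cycles. -/
theorem five_le_of_wheel {V : Type*} [Fintype V] [DecidableEq V] {G : SimpleGraph V} {m : ℕ}
    (hm : 6 ≤ m) (hV : Fintype.card V = m + 1) (f : ℕ → V)
    (hinj : ∀ i j, i ≤ m → j ≤ m → f i = f j → i = j)
    (hadj : ∀ i < m, G.Adj (f i) (f (i + 1))) (hlast : G.Adj (f m) (f 1))
    (hhub : ∀ i, 1 ≤ i → i ≤ m → G.Adj (f 0) (f i)) : 5 ≤ numHamiltonianCycles G := by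
  -- The `j`-th cycle replaces the rim edge from `f (j + 1)` to `f (j + 2)` by the spokes at its
  -- ends. Five such edges without wrapping around need six rim vertices.
  have hex : ∀ j : Fin 5, ∃ E ∈ hamiltonianCycles G, ∀ i, 1 ≤ i → i ≤ m →
      (s(f 0, f i) ∈ E ↔ i = j + 1 ∨ i = j + 2) := by
    intro j
    have hj := j.2
    -- From the hub `0`, `g` enters the rim at `j + 2` and goes once around it to `j + 1`.
    obtain ⟨g, hg⟩ : ∃ g : ℕ → ℕ, ∀ i, (i = 0 ∧ g i = 0) ∨
        (1 ≤ i ∧ i + j + 1 ≤ m ∧ g i = i + j + 1) ∨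
        (1 ≤ i ∧ m < i + j + 1 ∧ g i = i + j + 1 - m) := by
      refine ⟨fun i => if i = 0 then 0 else if i + j + 1 ≤ m then i + j + 1 else i + j + 1 - m,
        fun i => ?_⟩
      dsimp only
      split_ifs <;> omega
    have hgle : ∀ i ≤ m, g i ≤ m := fun i hi => by have := hg i; omega
    have hg0 : g 0 = 0 := by have := hg 0; omega
    have hgm : g m = j + 1 := by have := hg m; omega
    obtain ⟨E, hE, h⟩ := exists_mem_hamiltonianCycles (m := m) (G := G) (by omega) hV
      (fun i => f (g i)) (fun a b ha hb hab => by
        have := hinj _ _ (hgle a ha) (hgle b hb) hab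
        have := hg a; have := hg b; omega)
      (fun i hi => by
        have h1 := hg i; have h2 := hg (i + 1)
        rcases (by omega : g i = 0 ∧ 1 ≤ g (i + 1) ∧ g (i + 1) ≤ m ∨
          g i < m ∧ g (i + 1) = g i + 1 ∨ g i = m ∧ g (i + 1) = 1) with h | h | h
        · rw [h.1]; exact hhub _ h.2.1 h.2.2
        · rw [h.2]; exact hadj _ h.1
        · rw [h.1, h.2]; exact hlast)
      (by rw [hg0, hgm]; exact (hhub _ (by omega) (by omega)).symm)
    refine ⟨E, hE, fun i hi1 hi2 => ?_⟩
    have hf : ∀ x y, x ≤ m → y ≤ m → (f x = f y ↔ x = y) := fun x y hx hy =>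
      ⟨hinj x y hx hy, fun h => h ▸ rfl⟩
    rw [h]
    constructor
    · rintro (⟨a, ha, h⟩ | h)
      · rw [hf _ _ (by omega) (hgle a ha.le), hf _ _ (by omega) (hgle (a + 1) ha),
          hf _ _ (by omega) (hgle a ha.le), hf _ _ (by omega) (hgle (a + 1) ha)] at h
        have := hg a; have := hg (a + 1); omega
      · rw [hf _ _ (by omega) (hgle _ le_rfl), hf _ _ (by omega) (hgle _ (by omega)),
          hf _ _ (by omega) (hgle _ le_rfl), hf _ _ (by omega) (hgle _ (by omega))] at h
        omega
    · rintro (rfl | rfl)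
      · right; right; rw [hg0, hgm]; exact ⟨rfl, rfl⟩
      · left
        refine ⟨0, by omega, .inl ?_⟩
        have : g (0 + 1) = j + 2 := by have := hg (0 + 1); omega
        rw [this, hg0]; exact ⟨rfl, rfl⟩
  choose E hE h using hex
  have hEinj : Function.Injective E := by
    intro a b hab
    have ha := a.2
    have hb := b.2
    have h1 := (h a (a + 1) (by omega) (by omega)).2 (.inl rfl)
    have h2 := (h b (b + 1) (by omega) (by omega)).2 (.inl rfl)
    rw [hab, h b _ (by omega) (by omega)] at h1
    rw [← hab, h a _ (by omega) (by omega)] at h2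
    exact Fin.ext (by omega)
  have hc : (Set.range E).ncard = 5 := by
    rw [Set.ncard_range_of_injective hEinj]; simp
  rw [← hc]
  exact Set.ncard_le_ncard (by rintro _ ⟨j, rfl⟩; exact hE j) (Set.toFinite _)

/-- A graph on at least eight vertices in which one vertex is adjacent to all others, the others
having degree three, does not have exactly four Hamiltonian cycles: it is a wheel if it has any. -/
theorem numHamiltonianCycles_ne_four_of_dominating {V : Type*} [Fintype V] [DecidableEq V]
    {G : SimpleGraph V} [DecidableRel G.Adj] (hV : 8 ≤ Fintype.card V) {v : V}
    (hv : ∀ x, x ≠ v → G.Adj v x) (h3 : ∀ x, x ≠ v → G.degree x = 3) :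
    numHamiltonianCycles G ≠ 4 := by
  intro h4
  obtain ⟨E, hE⟩ : (hamiltonianCycles G).Nonempty := by
    rw [← Set.ncard_pos]
    have : (hamiltonianCycles G).ncard = 4 := h4
    omega
  obtain ⟨f, hf0, hfn, hadj, hinj⟩ := exists_enumeration hE v
  obtain ⟨m, hm⟩ : ∃ m, Fintype.card V = m + 1 := ⟨Fintype.card V - 1, by omega⟩
  rw [hm] at hfn hadj hinj
  have hne : ∀ i, 1 ≤ i → i ≤ m → f i ≠ v := fun i h1 h2 h => by
    have := hinj i 0 (by omega) (by omega) (h.trans hf0.symm); omega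
  have hsurj : ∀ x, ∃ i, i ≤ m ∧ f i = x := by
    have hinj' : Function.Injective (fun i : Fin (m + 1) => f i) := fun i j hij =>
      Fin.ext (hinj i j i.2 j.2 hij)
    have := (Fintype.bijective_iff_injective_and_card _).2 ⟨hinj', by simp [hm]⟩
    intro x
    obtain ⟨i, hi⟩ := this.2 x
    exact ⟨i, by omega, hi⟩
  have hthree : ∀ x a b c y, x ≠ v → G.Adj x a → G.Adj x b → G.Adj x c → G.Adj x y → a ≠ b → a ≠ c →
      b ≠ c → y = a ∨ y = b ∨ y = c := by
    intro x a b c y hx ha hb hc hy hab hac hbc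
    have hs : ({a, b, c} : Finset V) = G.neighborFinset x := by
      refine Finset.eq_of_subset_of_card_le ?_ ?_
      · intro z hz
        simp only [Finset.mem_insert, Finset.mem_singleton] at hz
        rw [SimpleGraph.mem_neighborFinset]
        rcases hz with rfl | rfl | rfl <;> assumption
      · rw [SimpleGraph.card_neighborFinset_eq_degree, h3 x hx,
          Finset.card_eq_three.2 ⟨a, b, c, hab, hac, hbc, rfl⟩]
    have := (SimpleGraph.mem_neighborFinset _ _ _).2 hy
    rw [← hs] at this
    simpa using this
  have hff : ∀ i j, i ≤ m → j ≤ m → i ≠ j → f i ≠ f j := fun i j hi hj hij h =>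
    hij (hinj i j (by omega) (by omega) h)
  -- Besides `v` and `f 2`, the vertex `f 1` has a third neighbour `f i`. If `i < m`, then `f i`
  -- would have the four neighbours `v`, `f (i - 1)`, `f (i + 1)` and `f 1`.
  have hlast : G.Adj (f m) (f 1) := by
    obtain ⟨y, hy1, hy2⟩ : ∃ y, G.Adj (f 1) y ∧ y ≠ v ∧ y ≠ f 2 := by
      by_contra! hcon
      have hsub : G.neighborFinset (f 1) ⊆ {v, f 2} := by
        intro y hy
        rw [SimpleGraph.mem_neighborFinset] at hy
        simp only [Finset.mem_insert, Finset.mem_singleton]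
        by_cases hyv : y = v
        · exact .inl hyv
        · exact .inr (hcon y hy hyv)
      have := (Finset.card_le_card hsub).trans Finset.card_le_two
      rw [SimpleGraph.card_neighborFinset_eq_degree, h3 _ (hne 1 le_rfl (by omega))] at this
      omega
    obtain ⟨i, hi, rfl⟩ := hsurj y
    have hi0 : i ≠ 0 := by rintro rfl; exact hy2.1 hf0
    have hi1 : i ≠ 1 := by rintro rfl; exact hy1.ne rfl
    have hi2 : i ≠ 2 := by rintro rfl; exact hy2.2 rfl
    by_contra hcon
    have him : i ≠ m := by rintro rfl; exact hcon hy1.symm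
    have hprev := (hadj (i - 1) (by omega)).symm
    rw [Nat.sub_add_cancel (by omega)] at hprev
    rcases hthree (f i) v (f (i - 1)) (f (i + 1)) (f 1) hy2.1 (hv _ hy2.1).symm hprev
      (hadj i (by omega)) hy1.symm (hne _ (by omega) (by omega)).symm
      (hne _ (by omega) (by omega)).symm (hff _ _ (by omega) (by omega) (by omega)) with h | h | h
    · exact hne 1 le_rfl (by omega) h
    · exact hff _ _ (by omega) (by omega) (by omega) h
    · exact hff _ _ (by omega) (by omega) (by omega) h
  have := five_le_of_wheel (G := G) (m := m) (by omega) hm f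
    (fun i j hi hj => hinj i j (by omega) (by omega)) (fun i hi => hadj i (by omega)) hlast
    (fun i h1 h2 => hf0 ▸ hv _ (hne i h1 h2))
  omega

theorem two_mul_add_four_le {k n : ℕ} (hk : 3 ≤ k) {G : SimpleGraph (Fin n)}
    (hG : IsFourCycleGraph k G) : 2 * k + 4 ≤ n := by
  classical
  obtain ⟨hreg, hnum⟩ := hG
  have hle := two_mul_add_two_le hreg
  have hdeg : ∀ v, G.degree v = 3 ∨ G.degree v = 2 * k + 1 := fun v => by
    convert hreg.1 v
  have heven : Even n := by
    have := even_card_of_odd_degree (G := G) fun v => by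
      rcases hdeg v with h | h <;> rw [h]
      · decide
      · exact odd_two_mul_add_one k
    simpa using this
  obtain ⟨c, rfl⟩ := heven
  by_contra hlt
  obtain rfl : c = k + 1 := by omega
  obtain ⟨t, ht⟩ : ∃ t, G.degree t = 3 := by
    obtain ⟨t, ht⟩ := hreg.2.1
    exact ⟨t, by convert ht⟩
  obtain ⟨v, hv⟩ : ∃ v, G.degree v = 2 * k + 1 := by
    obtain ⟨v, hv⟩ := hreg.2.2
    exact ⟨v, by convert hv⟩
  have hdom : ∀ v, G.degree v = 2 * k + 1 → ∀ x, x ≠ v → G.Adj v x := by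
    intro v hv x hx
    have hs : G.neighborFinset v = Finset.univ.erase v := by
      refine Finset.eq_of_subset_of_card_le (fun y hy => ?_) ?_
      · rw [SimpleGraph.mem_neighborFinset] at hy
        simpa using hy.ne'
      · rw [SimpleGraph.card_neighborFinset_eq_degree, hv,
          Finset.card_erase_of_mem (Finset.mem_univ v), Finset.card_univ, Fintype.card_fin]
        omega
    rw [← SimpleGraph.mem_neighborFinset, hs]
    simpa using hx
  obtain ⟨E, hE⟩ : (hamiltonianCycles G).Nonempty := by
    rw [← Set.ncard_pos]
    have : (hamiltonianCycles G).ncard = 4 := hnum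
    omega
  have hcard : 8 ≤ Fintype.card (Fin (k + 1 + (k + 1))) := by rw [Fintype.card_fin]; omega
  refine numHamiltonianCycles_ne_four_of_dominating hcard (hdom v hv)
    (fun x hx => (hdeg x).resolve_right fun hx' => ?_) hnum
  exact not_two_dominating hcard (isSpanningCycle_of_mem hE) hdeg hdom hx.symm hv hx' ht (by omega)

/-! ### Assembling the theorem -/

theorem isFourCycleGraph_join : IsFourCycleGraph 2 (natGraph 6 joinRel) :=
  ⟨isBiregular_join, numHamiltonianCycles_join⟩

theorem isFourCycleGraph_dumbbell {k : ℕ} (hk : 2 ≤ k) :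
    IsFourCycleGraph k (natGraph (2 * k + 4) (dumbbellRel k)) :=
  ⟨isBiregular_dumbbell hk, numHamiltonianCycles_dumbbell hk⟩

theorem isLeast_fourCycleOrders_two : IsLeast (fourCycleOrders 2) 6 :=
  ⟨⟨_, isFourCycleGraph_join⟩, fun _ ⟨_, hG⟩ => two_mul_add_two_le hG.1⟩

theorem isLeast_fourCycleOrders {k : ℕ} (hk : 3 ≤ k) :
    IsLeast (fourCycleOrders k) (2 * k + 4) :=
  ⟨⟨_, isFourCycleGraph_dumbbell (by omega)⟩, fun _ ⟨_, hG⟩ => two_mul_add_four_le hk hG⟩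

end HamCount

theorem mainTheorem4 :
    (∀ κ ∈ ({2, 3} : Set ℕ), ∀ k : ℕ, 2 ≤ k →
      ∃ (n : ℕ) (G : SimpleGraph (Fin n)),
        HamCount.IsBiregular G 3 (2 * k + 1) ∧ G.IsHamiltonian ∧
        HamCount.vertexConnectivity G = κ ∧ HamCount.numHamiltonianCycles G ≤ 4) ∧
    IsLeast (HamCount.fourCycleOrders 2) 6 ∧
    (∀ k : ℕ, 3 ≤ k → IsLeast (HamCount.fourCycleOrders k) (2 * k + 4)) ∧
    (∀ k : ℕ, 2 ≤ k →
      ∃ (n : ℕ) (G : SimpleGraph (Fin n)),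
        IsLeast (HamCount.fourCycleOrders k) n ∧ HamCount.IsFourCycleGraph k G ∧
        HamCount.vertexConnectivity G = 2) := by
  refine ⟨?_, HamCount.isLeast_fourCycleOrders_two, fun k hk => HamCount.isLeast_fourCycleOrders hk,
    fun k hk => ?_⟩
  · rintro κ (rfl | rfl) k hk
    · refine ⟨_, _, HamCount.isBiregular_dumbbell hk, ?_, HamCount.vertexConnectivity_dumbbell hk,
        (HamCount.numHamiltonianCycles_dumbbell hk).le⟩
      obtain ⟨E, hE, -⟩ := HamCount.exists_dumbbell hk True True
      exact HamCount.isHamiltonian_of_mem hE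
    -- With `k = j + 2`, the hub degree `2 * j + 5` is `2 * k + 1`.
    · obtain ⟨j, rfl⟩ := Nat.exists_eq_add_of_le' hk
      exact ⟨_, _, HamCount.isBiregular_threeHub j, HamCount.isHamiltonian_threeHub j,
        HamCount.vertexConnectivity_threeHub j, HamCount.ncard_le_four (HamCount.injOn_threeHub j)⟩
  -- For `k = 2` the dumbbell has eight vertices and is not minimal; the join takes its place.
  · obtain rfl | hk' := hk.eq_or_lt
    · exact ⟨6, _, HamCount.isLeast_fourCycleOrders_two, HamCount.isFourCycleGraph_join,
        HamCount.vertexConnectivity_join⟩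
    · exact ⟨_, _, HamCount.isLeast_fourCycleOrders hk', HamCount.isFourCycleGraph_dumbbell hk,
        HamCount.vertexConnectivity_dumbbell hk⟩
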